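/- Write $x=(x_1,x_2)$ for points of the Euclidean plane, $\mathbb{R}^2_+=\{x_2>0\}$, $\overline{\mathbb{R}^2_+}=\{x_2\ge 0\}$ and $\overline{B_r^+}=\{x:|x|\le r,\ x_2\ge 0\}$. A continuously differentiable mapping $w=(p,q)$ from an open set $\Omega\subset\mathbb{R}^2$ to $\mathbb{R}^2$ is called $K$-quasiconformal in $\Omega$ ($K>0$; injectivity is not required) if $$p_1^2+p_2^2+q_1^2+q_2^2\le 2K\,(p_1q_2-p_2q_1)\quad\text{in }\Omega,\qquad p_i=\frac{\partial p}{\partial x_i},\ q_i=\frac{\partial q}{\partial x_i}.$$ Theorem 4.3. Let $K\ge 1$, $0<R<R'$, $M\in\mathbb{R}$, and put $\alpha=K-\sqrt{K^2-1}$. There is a constant $C>0$ depending only on $K,R,R',M$ such that the following holds. Let $w=(p,q)$ be $K$-quasiconformal in $\mathbb{R}^2_+\setminus\overline{B_R^+}$, continuous up to $\{|x_1|>R,\ x_2=0\}$ (that is, $w$ is defined and continuous on the union of these two sets), with $q=0$ on $\{|x_1|>R,\ x_2=0\}$ and $|w|\le M$ in $\mathbb{R}^2_+\setminus\overline{B_R^+}$.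 Then $$|w(x)-w(y)|\le C|x-y|^{\alpha}\qquad\text{for all }x,y\in\overline{\mathbb{R}^2_+}\setminus\overline{B_{R'}^+},$$ and there is a number $p(\infty)\in\mathbb{R}$ such that, with $w(\infty)=(p(\infty),0)$, $w(x)\to w(\infty)$ as $|x|\to\infty$, $x\in\overline{\mathbb{R}^2_+}$, and $$|w(x)-w(\infty)|\le C|x|^{-\alpha}\qquad\text{for all }x\in\overline{\mathbb{R}^2_+}\setminus\overline{B_{R'}^+}.$$ -/

import Mathlib

open Filter Topology

/-- The Euclidean plane `ℝ²`; the coordinates `x₁, x₂` of the text are `x 0, x 1`. -/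
abbrev Plane : Type := EuclideanSpace ℝ (Fin 2)

/-- The partial derivative `∂f/∂xᵢ` of a real function on the plane. -/
noncomputable def partialD (i : Fin 2) (f : Plane → ℝ) (x : Plane) : ℝ :=
  fderiv ℝ f x (EuclideanSpace.single i 1)

/-- `w = (p, q)` is a (continuously differentiable) `K`-quasiconformal mapping in the open set `Ω`:
`p₁² + p₂² + q₁² + q₂² ≤ 2 K (p₁ q₂ - p₂ q₁)` everywhere in `Ω`, where `K > 0`.
Injectivity is not required. -/
structure IsQuasiconformalOn (K : ℝ) (w : Plane → Plane) (Ω : Set Plane) : Prop where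
  pos : 0 < K
  contDiffOn : ContDiffOn ℝ 1 w Ω
  distortion : ∀ x ∈ Ω,
    partialD 0 (fun y => w y 0) x ^ 2 + partialD 1 (fun y => w y 0) x ^ 2
      + partialD 0 (fun y => w y 1) x ^ 2 + partialD 1 (fun y => w y 1) x ^ 2
    ≤ 2 * K * (partialD 0 (fun y => w y 0) x * partialD 1 (fun y => w y 1) x
      - partialD 1 (fun y => w y 0) x * partialD 0 (fun y => w y 1) x)

/-- The open upper half-plane `ℝ²₊`. -/
def upperHalf : Set Plane := {x | 0 < x 1}

/-- The closed upper half-plane. -/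
def closedUpperHalf : Set Plane := {x | 0 ≤ x 1}

/-- The closed half-disc `{|x| ≤ r, x₂ ≥ 0}`, the closure of `B_r⁺` for `r > 0`. -/
def closedHalfDisc (r : ℝ) : Set Plane := Metric.closedBall 0 r ∩ closedUpperHalf

/-- The flat boundary part `{|x₁| > r, x₂ = 0}`. -/
def flatBoundary (r : ℝ) : Set Plane := {x | r < |x 0| ∧ x 1 = 0}

/-!
The energy `∫ J` of a quasiconformal map over a domain is, by Stokes' formula, the flux `∫ q dp`
through its boundary. On a circle, or on a half-circle at whose end points `q = 0`, Wirtinger's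
inequality bounds the flux by the energy of the slice, and the exponent `α = K - √(K² - 1)` is the
ratio between the Jacobian and the square of the tangential derivative
(`expo_mul_le_jac`). In logarithmic polar coordinates `s + i θ`, where both the Jacobian integral and
the quasiconformality condition are invariant, this says that the flux `F` satisfies
`F' ≤ -2 α |F|`. A bound for `|q|` gives moreover `F' ≤ -c F²`, which excludes negative values and
bounds `F` on the interior in terms of `c` only (`flux_nonneg`, `flux_le`). Hence the energy decays
like `ρ ^ (2 α)` on discs and on half-discs centered on the boundary, and like `ρ ^ (-2 α)` outside
half-discs of radius `ρ → ∞` (`QC.energy_disc_le`, `QC.energy_halfDisc_le`, `QC.energy_exterior_le`).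

Two points need care. The map is only `C¹`, so Stokes' formula is proved by differentiating the
flux through a difference quotient, integrated by parts along the slice
(`hasDerivAt_integral_mul_dy`). At the flat boundary the map is only continuous, so `q` is replaced
by a function `trunc δ q` that vanishes where `|q| ≤ δ`; the truncation is chosen so that the flux
inequality survives with the same constant (`abs_trunc_le`, `QC.strip_flux`), and `δ → 0`
recovers the full energy because the Jacobian vanishes almost everywhere on `{q = 0}`.

Morrey's lemma on squares (`abs_sub_le_of_morrey`) turns the growth of the energy into the Hölder
estimate `|w x - w y| ≤ C |x - y| ^ α r ^ (-2 α)` for points at distance at least `r` from the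
origin and `|x - y|` small compared with `r` (`exists_holderFar`). For distant points the bound for
`|w|` suffices. Chaining this estimate over half-annuli and summing over dyadic radii gives an
oscillation of order `r ^ (-α)` outside the half-disc of radius `r` (`exists_oscillation_bound`),
hence the limit at infinity and the rate of convergence.
-/

open MeasureTheory Set

/-! ### The exponent, Wirtinger's inequality and a differential inequality -/

theorem expo_pos {K : ℝ} (hK : 1 ≤ K) : 0 < K - √(K ^ 2 - 1) := by
  have : √(K ^ 2 - 1) < K := by
    rw [Real.sqrt_lt' (by linarith)]; linarith
  linarith

/-- In any orthonormal frame the exponent is the sharp ratio between the Jacobian and the energy in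
one direction. -/
theorem expo_mul_le_jac {K a b c d : ℝ} (hK : 1 ≤ K)
    (h : a ^ 2 + b ^ 2 + c ^ 2 + d ^ 2 ≤ 2 * K * (a * d - b * c)) :
    (K - √(K ^ 2 - 1)) * (b ^ 2 + d ^ 2) ≤ a * d - b * c := by
  have hs : √(K ^ 2 - 1) ^ 2 = K ^ 2 - 1 := Real.sq_sqrt (by nlinarith)
  have h0 : 0 ≤ √(K ^ 2 - 1) := Real.sqrt_nonneg _
  set r := √(K ^ 2 - 1)
  have hlt : r < K := by nlinarith
  rcases eq_or_lt_of_le (show 0 ≤ b ^ 2 + d ^ 2 by positivity) with hT | hT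
  · rw [← hT, mul_zero]; nlinarith [sq_nonneg a, sq_nonneg c]
  · -- the ratio of Jacobian to `b² + d²` lies between the roots of `x² - 2Kx + 1`
    have hcs : (a * d - b * c) ^ 2 ≤ (a ^ 2 + c ^ 2) * (b ^ 2 + d ^ 2) := by
      nlinarith [sq_nonneg (a * b + c * d)]
    by_contra! hlt'
    set T := b ^ 2 + d ^ 2
    set J := a * d - b * c
    have h1 : J ^ 2 + T ^ 2 ≤ 2 * K * J * T := by nlinarith
    have h2 : 0 < ((K - r) * T - J) * ((K + r) * T - J) := by
      apply mul_pos <;> nlinarith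
    nlinarith

section Wirtinger

/-- The function whose derivative is compared with `f' ^ 2 - f ^ 2` in Wirtinger's inequality. Where
`sin (t - a)` vanishes, the quotient has the junk value `0`; since `f` vanishes there too, `0` is also the limit. -/
theorem continuousAt_sq_mul_cot {f : ℝ → ℝ} {f' a c : ℝ} (hf : HasDerivAt f f' c) (h0 : f c = 0) :
    ContinuousAt (fun t => f t ^ 2 * (Real.cos (t - a) / Real.sin (t - a))) c := by
  have hsin : HasDerivAt (fun t => Real.sin (t - a)) (Real.cos (c - a)) c := by
    simpa using ((hasDerivAt_id c).sub_const a).sin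
  by_cases hs : Real.sin (c - a) = 0
  · have hcos : Real.cos (c - a) ≠ 0 := by
      intro h; have := Real.sin_sq_add_cos_sq (c - a); simp [hs, h] at this
    rw [continuousAt_iff_punctured_nhds]
    have h1 := (hasDerivAt_iff_tendsto_slope.1 hf).div (hasDerivAt_iff_tendsto_slope.1 hsin) hcos
    have h2 : Tendsto (fun t => f t * Real.cos (t - a)) (𝓝[≠] c) (𝓝 (f c * Real.cos (c - a))) :=
      (hf.continuousAt.mul (by fun_prop)).tendsto.mono_left nhdsWithin_le_nhds
    have h3 := h2.mul h1
    simp only [h0, zero_mul] at h3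
    simp only [h0, ne_eq, OfNat.ofNat_ne_zero, not_false_eq_true, zero_pow, zero_mul]
    refine h3.congr' ?_
    filter_upwards [self_mem_nhdsWithin] with t ht
    have ht' : t - c ≠ 0 := sub_ne_zero.2 ht
    simp only [Pi.div_apply, slope_def_field, h0, hs, sub_zero]
    field_simp
  · exact (hf.continuousAt.pow 2).mul (ContinuousAt.div (by fun_prop) (by fun_prop) hs)

/-- Wirtinger's inequality for functions vanishing at the end points of an interval of length at
most `π`. -/
theorem integral_sq_le_integral_deriv_sq {f f' : ℝ → ℝ} {a b : ℝ} (hab : a ≤ b) (hb : b ≤ a + Real.pi)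
    (hf : ∀ t ∈ Icc a b, HasDerivAt f (f' t) t) (hc : ContinuousOn f' (Icc a b))
    (h0 : f a = 0) (h1 : f b = 0) :
    ∫ t in a..b, f t ^ 2 ≤ ∫ t in a..b, f' t ^ 2 := by
  have hfc : ContinuousOn f (Icc a b) := fun t ht => (hf t ht).continuousAt.continuousWithinAt
  have i1 : IntervalIntegrable (fun t => f t ^ 2) volume a b :=
    ContinuousOn.intervalIntegrable (by rw [uIcc_of_le hab]; exact hfc.pow 2)
  have i2 : IntervalIntegrable (fun t => f' t ^ 2) volume a b :=
    ContinuousOn.intervalIntegrable (by rw [uIcc_of_le hab]; exact hc.pow 2)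
  have hsin : ∀ t ∈ Ioo a b, 0 < Real.sin (t - a) := fun t ht =>
    Real.sin_pos_of_pos_of_lt_pi (by linarith [ht.1]) (by linarith [ht.2])
  have key := intervalIntegral.sub_le_integral_of_hasDeriv_right_of_le
    (g := fun t => f t ^ 2 * (Real.cos (t - a) / Real.sin (t - a)))
    (g' := fun t => 2 * f t * f' t * (Real.cos (t - a) / Real.sin (t - a))
      - f t ^ 2 * (1 + (Real.cos (t - a) / Real.sin (t - a)) ^ 2))
    (φ := fun t => f' t ^ 2 - f t ^ 2) hab ?_ ?_ ?_ ?_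
  · rw [intervalIntegral.integral_sub i2 i1] at key
    simp only [h0, h1] at key
    linarith
  · intro t ht
    rcases eq_or_ne t a with rfl | hta
    · exact (continuousAt_sq_mul_cot (hf t ht) h0).continuousWithinAt
    rcases eq_or_ne t b with rfl | htb
    · exact (continuousAt_sq_mul_cot (hf t ht) h1).continuousWithinAt
    have := hsin t ⟨lt_of_le_of_ne ht.1 hta.symm, lt_of_le_of_ne ht.2 htb⟩
    exact (((hf t ht).continuousAt.pow 2).mul
      (ContinuousAt.div (by fun_prop) (by fun_prop) this.ne')).continuousWithinAt
  · intro t ht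
    have hs := (hsin t ht).ne'
    have hd1 : HasDerivAt (fun t => Real.sin (t - a)) (Real.cos (t - a)) t := by
      simpa using ((hasDerivAt_id t).sub_const a).sin
    have hd2 : HasDerivAt (fun t => Real.cos (t - a)) (-Real.sin (t - a)) t := by
      simpa using ((hasDerivAt_id t).sub_const a).cos
    have := ((hf t ⟨ht.1.le, ht.2.le⟩).pow 2).mul (hd2.div hd1 hs)
    refine (this.congr_deriv ?_).hasDerivWithinAt
    simp only [Pi.div_apply, Pi.pow_apply]
    field_simp
    ring
  · exact ((i2.sub i1).1).mono_set_ae (by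
      filter_upwards [Measure.ae_ne volume a] with x hx hx2
      exact ⟨lt_of_le_of_ne hx2.1 hx.symm, hx2.2⟩)
  · intro t _
    nlinarith [sq_nonneg (f' t - f t * (Real.cos (t - a) / Real.sin (t - a)))]

end Wirtinger

section Decay

variable {F j : ℝ → ℝ} {a b c : ℝ}

theorem antitoneOn_flux (hF : ∀ s, a < s → HasDerivAt F (-j s) s)
    (hcF : ∀ s, a < s → c * F s ^ 2 ≤ j s) (hc : 0 < c) : AntitoneOn F (Ioi a) := by
  apply antitoneOn_of_deriv_nonpos (convex_Ioi a)
  · exact fun s hs => (hF s hs).continuousAt.continuousWithinAt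
  · rw [interior_Ioi]; exact fun s hs => (hF s hs).differentiableAt.differentiableWithinAt
  · rw [interior_Ioi]; intro s hs; rw [(hF s hs).deriv]
    have := hcF s hs
    nlinarith [sq_nonneg (F s)]

/-- `1 / F` grows at least linearly as long as `F` does not vanish. -/
theorem flux_inv_ge (hF : ∀ s, a < s → HasDerivAt F (-j s) s)
    (hcF : ∀ s, a < s → c * F s ^ 2 ≤ j s) {s t : ℝ} (hs : a < s) (hst : s ≤ t)
    (hne : ∀ x ∈ Icc s t, F x ≠ 0) : (F s)⁻¹ + c * (t - s) ≤ (F t)⁻¹ := by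
  have hd : ∀ x ∈ Icc s t, HasDerivAt (fun x => (F x)⁻¹ - c * x) (j x / F x ^ 2 - c) x := by
    intro x hx
    have := ((hF x (hs.trans_le hx.1)).inv (hne x hx)).sub ((hasDerivAt_id x).const_mul c)
    refine this.congr_deriv ?_
    simp
  have hm : MonotoneOn (fun x => (F x)⁻¹ - c * x) (Icc s t) := by
    apply monotoneOn_of_deriv_nonneg (convex_Icc s t)
    · exact fun x hx => (hd x hx).continuousAt.continuousWithinAt
    · exact fun x hx => (hd x (interior_subset hx)).differentiableAt.differentiableWithinAt
    · intro x hx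
      have hx' := interior_subset hx
      rw [(hd x hx').deriv, sub_nonneg, le_div_iff₀ (by have := hne x hx'; positivity)]
      exact hcF x (hs.trans_le hx'.1)
  have := hm (left_mem_Icc.2 hst) (right_mem_Icc.2 hst) hst
  simp only at this
  linarith

/-- A negative value would persist, and then `1 / F` would reach zero in finite time. -/
theorem flux_nonneg (hF : ∀ s, a < s → HasDerivAt F (-j s) s)
    (hcF : ∀ s, a < s → c * F s ^ 2 ≤ j s) (hc : 0 < c) {s : ℝ} (hs : a < s) : 0 ≤ F s := by
  by_contra! hneg
  have hle : ∀ x, s ≤ x → F x < 0 := fun x hx =>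
    (antitoneOn_flux hF hcF hc hs (hs.trans_le hx) hx).trans_lt hneg
  have hinv : 0 < -(F s)⁻¹ := by
    have := inv_lt_zero.2 hneg; linarith
  have hpos : 0 ≤ -(F s)⁻¹ / c := by positivity
  have h1 := flux_inv_ge hF hcF hs (t := s + -(F s)⁻¹ / c) (by linarith)
    (fun x hx => (hle x hx.1).ne)
  have h2 := inv_lt_zero.2 (hle (s + -(F s)⁻¹ / c) (by linarith))
  have h3 : c * (s + -(F s)⁻¹ / c - s) = -(F s)⁻¹ := by field_simp; ring
  linarith

/-- A bound that does not depend on the values of `F` near the left end point. -/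
theorem flux_le (hF : ∀ s, a < s → HasDerivAt F (-j s) s)
    (hcF : ∀ s, a < s → c * F s ^ 2 ≤ j s) (hc : 0 < c) {s t : ℝ} (hs : a < s) (hst : s < t) :
    F t ≤ 1 / (c * (t - s)) := by
  have hcs : 0 < c * (t - s) := mul_pos hc (by linarith)
  rcases (flux_nonneg hF hcF hc (hs.trans hst)).eq_or_lt with h | h
  · rw [← h]; positivity
  · have hpos : ∀ x ∈ Icc s t, 0 < F x := fun x hx =>
      h.trans_le (antitoneOn_flux hF hcF hc (hs.trans_le hx.1) (hs.trans hst) hx.2)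
    have h1 := flux_inv_ge hF hcF hs hst.le (fun x hx => (hpos x hx).ne')
    have h2 := inv_pos.2 (hpos s (left_mem_Icc.2 hst.le))
    rw [one_div, ← inv_inv (F t)]
    exact inv_anti₀ hcs (by linarith)

theorem flux_exp_decay (hF : ∀ s, a < s → HasDerivAt F (-j s) s)
    (hbF : ∀ s, a < s → b * |F s| ≤ j s) (hb : 0 < b) {s t : ℝ} (hs : a < s) (hst : s ≤ t) :
    F t ≤ Real.exp (-(b * (t - s))) * F s := by
  have hd : ∀ x, a < x → HasDerivAt (fun x => Real.exp (b * x) * F x)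
      (Real.exp (b * x) * (b * F x - j x)) x := by
    intro x hx
    have := (((hasDerivAt_id x).const_mul b).exp).mul (hF x hx)
    refine this.congr_deriv ?_
    simp only [id, mul_one]; ring
  have hm : AntitoneOn (fun x => Real.exp (b * x) * F x) (Icc s t) := by
    apply antitoneOn_of_deriv_nonpos (convex_Icc s t)
    · exact fun x hx => (hd x (hs.trans_le hx.1)).continuousAt.continuousWithinAt
    · exact fun x hx =>
        (hd x (hs.trans_le (interior_subset hx).1)).differentiableAt.differentiableWithinAt
    · intro x hx
      have hx' := hs.trans_le (interior_subset hx).1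
      rw [(hd x hx').deriv]
      apply mul_nonpos_of_nonneg_of_nonpos (Real.exp_pos _).le
      have h1 := hbF x hx'
      nlinarith [mul_le_mul_of_nonneg_left (le_abs_self (F x)) hb.le]
  have := hm (left_mem_Icc.2 hst) (right_mem_Icc.2 hst) hst
  simp only at this
  have h2 : Real.exp (-(b * (t - s))) = Real.exp (b * s) / Real.exp (b * t) := by
    rw [← Real.exp_sub]; ring_nf
  rw [h2, div_mul_eq_mul_div, le_div_iff₀ (Real.exp_pos _)]
  linarith

/-- The flux tends to zero, so it equals the energy beyond the slice. -/
theorem lintegral_Ioi_flux (hF : ∀ s, a < s → HasDerivAt F (-j s) s)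
    (hbF : ∀ s, a < s → b * |F s| ≤ j s) (hcF : ∀ s, a < s → c * F s ^ 2 ≤ j s)
    (hb : 0 < b) (hc : 0 < c) {s : ℝ} (hs : a < s) :
    ∫⁻ t in Ioi s, ENNReal.ofReal (j t) = ENNReal.ofReal (F s) := by
  have hj : ∀ t, a < t → 0 ≤ j t := fun t ht => (by positivity : 0 ≤ b * |F t|).trans (hbF t ht)
  have hlim : Tendsto F atTop (𝓝 0) := by
    have hexp : Tendsto (fun t => Real.exp (-(b * (t - s))) * F s) atTop (𝓝 0) := by
      rw [← zero_mul (F s)]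
      refine Tendsto.mul_const _ (Real.tendsto_exp_neg_atTop_nhds_zero.comp ?_)
      exact (tendsto_id.atTop_add tendsto_const_nhds).const_mul_atTop hb
    refine tendsto_of_tendsto_of_tendsto_of_le_of_le' tendsto_const_nhds hexp ?_ ?_
    · filter_upwards [eventually_gt_atTop a] with t ht using flux_nonneg hF hcF hc ht
    · filter_upwards [eventually_ge_atTop s] with t ht using flux_exp_decay hF hbF hb hs ht
  have hcont : ContinuousWithinAt F (Ici s) s := (hF s hs).continuousAt.continuousWithinAt
  have hi := integrableOn_Ioi_deriv_of_nonpos hcont (fun x hx => hF x (hs.trans hx))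
    (fun x hx => neg_nonpos.2 (hj x (hs.trans hx))) hlim
  have hv := integral_Ioi_of_hasDerivAt_of_nonpos hcont (fun x hx => hF x (hs.trans hx))
    (fun x hx => neg_nonpos.2 (hj x (hs.trans hx))) hlim
  have hi' : IntegrableOn j (Ioi s) := by simpa using hi.neg
  rw [integral_neg] at hv
  rw [← ofReal_integral_eq_lintegral_ofReal hi']
  · congr 1; linarith
  · filter_upwards [ae_restrict_mem measurableSet_Ioi] with t ht using hj t (hs.trans ht)

end Decay

/-! ### Slices and the flux -/

/-- The derivative of `f` along the first coordinate. -/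
noncomputable def dx (f : ℝ × ℝ → ℝ) (z : ℝ × ℝ) : ℝ := fderiv ℝ f z (1, 0)

/-- The derivative of `f` along the second coordinate. -/
noncomputable def dy (f : ℝ × ℝ → ℝ) (z : ℝ × ℝ) : ℝ := fderiv ℝ f z (0, 1)

/-- The Jacobian determinant of `(p, q)`. -/
noncomputable def jac (p q : ℝ × ℝ → ℝ) (z : ℝ × ℝ) : ℝ := dx p z * dy q z - dy p z * dx q z

/-- Quasiconformality of `(p, q)` in an open subset of the coordinate plane `ℝ × ℝ`. -/
structure QC (K : ℝ) (p q : ℝ × ℝ → ℝ) (U : Set (ℝ × ℝ)) : Prop where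
  contDiffOn_fst : ContDiffOn ℝ 1 p U
  contDiffOn_snd : ContDiffOn ℝ 1 q U
  distortion : ∀ z ∈ U, dx p z ^ 2 + dy p z ^ 2 + dx q z ^ 2 + dy q z ^ 2 ≤ 2 * K * jac p q z

section Slices

variable {f H P Q : ℝ × ℝ → ℝ} {U : Set (ℝ × ℝ)}

theorem continuousOn_dx (hU : IsOpen U) (hf : ContDiffOn ℝ 1 f U) : ContinuousOn (dx f) U :=
  (hf.continuousOn_fderiv_of_isOpen hU le_rfl).clm_apply continuousOn_const

theorem continuousOn_dy (hU : IsOpen U) (hf : ContDiffOn ℝ 1 f U) : ContinuousOn (dy f) U :=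
  (hf.continuousOn_fderiv_of_isOpen hU le_rfl).clm_apply continuousOn_const

theorem measurable_jac : Measurable (jac P Q) := by
  unfold jac dx dy
  exact ((measurable_fderiv_apply_const ℝ P _).mul (measurable_fderiv_apply_const ℝ Q _)).sub
    ((measurable_fderiv_apply_const ℝ P _).mul (measurable_fderiv_apply_const ℝ Q _))

theorem continuousOn_jac (hU : IsOpen U) (hP : ContDiffOn ℝ 1 P U) (hQ : ContDiffOn ℝ 1 Q U) :
    ContinuousOn (jac P Q) U :=
  ((continuousOn_dx hU hP).mul (continuousOn_dy hU hQ)).sub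
    ((continuousOn_dy hU hP).mul (continuousOn_dx hU hQ))

theorem hasFDerivAt_of_contDiffOn (hU : IsOpen U) (hf : ContDiffOn ℝ 1 f U) {z : ℝ × ℝ}
    (hz : z ∈ U) : HasFDerivAt f (fderiv ℝ f z) z :=
  ((hf.contDiffAt (hU.mem_nhds hz)).differentiableAt one_ne_zero).hasFDerivAt

theorem hasDerivAt_fst_slice (hU : IsOpen U) (hf : ContDiffOn ℝ 1 f U) {s t : ℝ} (hz : (s, t) ∈ U) :
    HasDerivAt (fun s => f (s, t)) (dx f (s, t)) s :=
  (hasFDerivAt_of_contDiffOn hU hf hz).comp_hasDerivAt s ((hasDerivAt_id s).prodMk (hasDerivAt_const s t))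

theorem hasDerivAt_snd_slice (hU : IsOpen U) (hf : ContDiffOn ℝ 1 f U) {s t : ℝ} (hz : (s, t) ∈ U) :
    HasDerivAt (fun t => f (s, t)) (dy f (s, t)) t :=
  (hasFDerivAt_of_contDiffOn hU hf hz).comp_hasDerivAt t ((hasDerivAt_const t s).prodMk (hasDerivAt_id t))

theorem dx_comp (hU : IsOpen U) (hf : ContDiffOn ℝ 1 f U) {z : ℝ × ℝ} (hz : z ∈ U) {φ : ℝ → ℝ}
    {φ' : ℝ} (hφ : HasDerivAt φ φ' (f z)) : dx (fun z => φ (f z)) z = φ' * dx f z := by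
  have := hφ.comp_hasFDerivAt z (hasFDerivAt_of_contDiffOn hU hf hz)
  change fderiv ℝ (φ ∘ f) z (1, 0) = _
  rw [this.fderiv]; rfl

theorem dy_comp (hU : IsOpen U) (hf : ContDiffOn ℝ 1 f U) {z : ℝ × ℝ} (hz : z ∈ U) {φ : ℝ → ℝ}
    {φ' : ℝ} (hφ : HasDerivAt φ φ' (f z)) : dy (fun z => φ (f z)) z = φ' * dy f z := by
  have := hφ.comp_hasFDerivAt z (hasFDerivAt_of_contDiffOn hU hf hz)
  change fderiv ℝ (φ ∘ f) z (0, 1) = _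
  rw [this.fderiv]; rfl

theorem continuousOn_slice {g : ℝ × ℝ → ℝ} {s t₀ t₁ : ℝ} (hg : ContinuousOn g U)
    (hs : ∀ t ∈ Icc t₀ t₁, (s, t) ∈ U) : ContinuousOn (fun t => g (s, t)) (Icc t₀ t₁) :=
  hg.comp (by fun_prop) hs

theorem intervalIntegrable_slice {g : ℝ × ℝ → ℝ} {s t₀ t₁ : ℝ} (h01 : t₀ ≤ t₁)
    (hg : ContinuousOn g U) (hs : ∀ t ∈ Icc t₀ t₁, (s, t) ∈ U) :
    IntervalIntegrable (fun t => g (s, t)) volume t₀ t₁ :=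
  ContinuousOn.intervalIntegrable (by rw [uIcc_of_le h01]; exact continuousOn_slice hg hs)

/-- Stokes' formula on thin rectangles, for functions that are only `C¹`: the derivative of
`∫ H P_θ dθ` involves no second derivatives of `P`, because the difference quotient can be
integrated by parts in `θ`. -/
theorem hasDerivAt_integral_mul_dy (hU : IsOpen U) (hH : ContDiffOn ℝ 1 H U)
    (hP : ContDiffOn ℝ 1 P U) {s₀ t₀ t₁ r : ℝ} (hr : 0 < r) (h01 : t₀ ≤ t₁)
    (hsub : Icc (s₀ - r) (s₀ + r) ×ˢ Icc t₀ t₁ ⊆ U)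
    (hb : ∀ s ∈ Icc (s₀ - r) (s₀ + r), ∀ s' ∈ Icc (s₀ - r) (s₀ + r),
      H (s, t₁) * P (s', t₁) = H (s, t₀) * P (s', t₀)) :
    HasDerivAt (fun s => ∫ t in t₀..t₁, H (s, t) * dy P (s, t))
      (∫ t in t₀..t₁, (dx H (s₀, t) * dy P (s₀, t) - dy H (s₀, t) * dx P (s₀, t))) s₀ := by
  have hs₀ : s₀ ∈ Icc (s₀ - r) (s₀ + r) := ⟨by linarith, by linarith⟩
  have hm : ∀ s ∈ Icc (s₀ - r) (s₀ + r), ∀ t ∈ Icc t₀ t₁, (s, t) ∈ U := fun s hs t ht =>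
    hsub ⟨hs, ht⟩
  have hcomp : IsCompact (Icc (s₀ - r) (s₀ + r) ×ˢ Icc t₀ t₁) := isCompact_Icc.prod isCompact_Icc
  obtain ⟨C₁, hC₁⟩ := hcomp.exists_bound_of_continuousOn ((continuousOn_dx hU hH).mono hsub)
  obtain ⟨C₂, hC₂⟩ := hcomp.exists_bound_of_continuousOn ((continuousOn_dy hU hH).mono hsub)
  obtain ⟨C₃, hC₃⟩ := hcomp.exists_bound_of_continuousOn ((continuousOn_dx hU hP).mono hsub)
  obtain ⟨C₄, hC₄⟩ := hcomp.exists_bound_of_continuousOn ((continuousOn_dy hU hP).mono hsub)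
  have lip : ∀ {g : ℝ × ℝ → ℝ} {C : ℝ}, ContDiffOn ℝ 1 g U →
      (∀ z ∈ Icc (s₀ - r) (s₀ + r) ×ˢ Icc t₀ t₁, ‖dx g z‖ ≤ C) →
      ∀ s ∈ Icc (s₀ - r) (s₀ + r), ∀ t ∈ Icc t₀ t₁, s ≠ s₀ →
        |(s - s₀)⁻¹ * (g (s, t) - g (s₀, t))| ≤ C := by
    intro g C hg hC s hs t ht hne
    have := (convex_Icc (s₀ - r) (s₀ + r)).norm_image_sub_le_of_norm_hasDerivWithin_le
      (f := fun s => g (s, t)) (f' := fun s => dx g (s, t))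
      (fun x hx => (hasDerivAt_fst_slice hU hg (hm x hx t ht)).hasDerivWithinAt)
      (fun x hx => hC (x, t) ⟨hx, ht⟩) hs₀ hs
    rw [abs_mul, abs_inv, inv_mul_le_iff₀ (abs_pos.2 (sub_ne_zero.2 hne))]
    simpa [Real.norm_eq_abs, mul_comm] using this
  have hnear : ∀ᶠ s in 𝓝[≠] s₀, s ∈ Icc (s₀ - r) (s₀ + r) ∧ s ≠ s₀ := by
    refine Filter.Eventually.and ?_ self_mem_nhdsWithin
    exact nhdsWithin_le_nhds (Icc_mem_nhds (by linarith) (by linarith))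
  rw [hasDerivAt_iff_tendsto_slope]
  have hlim : Tendsto (fun s => ∫ t in t₀..t₁,
      ((s - s₀)⁻¹ * (H (s, t) - H (s₀, t)) * dy P (s, t)
        - dy H (s₀, t) * ((s - s₀)⁻¹ * (P (s, t) - P (s₀, t))))) (𝓝[≠] s₀)
      (𝓝 (∫ t in t₀..t₁, (dx H (s₀, t) * dy P (s₀, t) - dy H (s₀, t) * dx P (s₀, t)))) := by
    apply intervalIntegral.tendsto_integral_filter_of_dominated_convergence
      (fun _ => C₁ * C₄ + C₂ * C₃)
    · filter_upwards [hnear] with s hs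
      have hc : ∀ {g : ℝ × ℝ → ℝ}, ContinuousOn g U → ∀ x ∈ Icc (s₀ - r) (s₀ + r),
        ContinuousOn (fun t => g (x, t)) (Icc t₀ t₁) := fun hg x hx =>
          continuousOn_slice hg (hm x hx)
      rw [uIoc_of_le h01]
      refine (ContinuousOn.mono ?_ Ioc_subset_Icc_self).aestronglyMeasurable measurableSet_Ioc
      exact ((continuousOn_const.mul ((hc hH.continuousOn s hs.1).sub
        (hc hH.continuousOn s₀ hs₀))).mul (hc (continuousOn_dy hU hP) s hs.1)).sub
        ((hc (continuousOn_dy hU hH) s₀ hs₀).mul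
          (continuousOn_const.mul ((hc hP.continuousOn s hs.1).sub (hc hP.continuousOn s₀ hs₀))))
    · filter_upwards [hnear] with s hs
      refine Eventually.of_forall fun t ht => ?_
      rw [uIoc_of_le h01] at ht
      have ht' := Ioc_subset_Icc_self ht
      have e1 := lip hH hC₁ s hs.1 t ht' hs.2
      have e2 := lip hP hC₃ s hs.1 t ht' hs.2
      have e3 := hC₄ (s, t) ⟨hs.1, ht'⟩
      have e4 := hC₂ (s₀, t) ⟨hs₀, ht'⟩
      refine (norm_sub_le _ _).trans (add_le_add ?_ ?_)
      · rw [norm_mul]; exact mul_le_mul e1 e3 (norm_nonneg _) ((abs_nonneg _).trans e1)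
      · rw [norm_mul]; exact mul_le_mul e4 e2 (norm_nonneg _) ((norm_nonneg _).trans e4)
    · exact intervalIntegrable_const
    · refine Eventually.of_forall fun t ht => ?_
      rw [uIoc_of_le h01] at ht
      have hz := hm s₀ hs₀ t (Ioc_subset_Icc_self ht)
      have a1 := hasDerivAt_iff_tendsto_slope.1 (hasDerivAt_fst_slice hU hH hz)
      have a2 := hasDerivAt_iff_tendsto_slope.1 (hasDerivAt_fst_slice hU hP hz)
      have a3 : Tendsto (fun s => dy P (s, t)) (𝓝[≠] s₀) (𝓝 (dy P (s₀, t))) := by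
        have := ((continuousOn_dy hU hP).continuousAt (hU.mem_nhds hz)).comp
          (f := fun s : ℝ => (s, t)) (x := s₀) (by fun_prop)
        exact this.tendsto.mono_left nhdsWithin_le_nhds
      have := (a1.mul a3).sub (a2.const_mul (dy H (s₀, t)))
      simpa only [slope_def_field, div_eq_inv_mul] using this
  refine hlim.congr' ?_
  filter_upwards [hnear] with s hs
  have hi : ∀ {g k : ℝ × ℝ → ℝ}, ContinuousOn g U → ContinuousOn k U →
      ∀ x ∈ Icc (s₀ - r) (s₀ + r), ∀ y ∈ Icc (s₀ - r) (s₀ + r),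
      IntervalIntegrable (fun t => g (x, t) * k (y, t)) volume t₀ t₁ := fun hg hk x hx y hy =>
    ContinuousOn.intervalIntegrable (by
      rw [uIcc_of_le h01]
      exact (continuousOn_slice hg (hm x hx)).mul (continuousOn_slice hk (hm y hy)))
  have hHc := hH.continuousOn
  have hPc := hP.continuousOn
  have hPy := continuousOn_dy hU hP
  have hHy := continuousOn_dy hU hH
  -- integration by parts moves the `θ`-derivative from `P (s, ·) - P (s₀, ·)` to `H (s₀, ·)`
  have parts : ∀ y ∈ Icc (s₀ - r) (s₀ + r), ∫ t in t₀..t₁, H (s₀, t) * dy P (y, t)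
      = - ∫ t in t₀..t₁, dy H (s₀, t) * P (y, t) := by
    intro y hy
    rw [intervalIntegral.integral_mul_deriv_eq_deriv_mul (u := fun t => H (s₀, t))
      (v := fun t => P (y, t)) (u' := fun t => dy H (s₀, t))]
    · rw [hb s₀ hs₀ y hy]; ring
    · intro t ht; rw [uIcc_of_le h01] at ht; exact hasDerivAt_snd_slice hU hH (hm s₀ hs₀ t ht)
    · intro t ht; rw [uIcc_of_le h01] at ht; exact hasDerivAt_snd_slice hU hP (hm y hy t ht)
    · exact intervalIntegrable_slice h01 hHy (hm s₀ hs₀)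
    · exact intervalIntegrable_slice h01 hPy (hm y hy)
  have i1 := hi hHc hPy s hs.1 s hs.1
  have i2 := hi hHc hPy s₀ hs₀ s hs.1
  have i3 := hi hHy hPc s₀ hs₀ s hs.1
  have i4 := hi hHy hPc s₀ hs₀ s₀ hs₀
  have expand : ∀ t, (s - s₀)⁻¹ * (H (s, t) - H (s₀, t)) * dy P (s, t)
        - dy H (s₀, t) * ((s - s₀)⁻¹ * (P (s, t) - P (s₀, t)))
      = (s - s₀)⁻¹ * ((H (s, t) * dy P (s, t) - H (s₀, t) * dy P (s, t))
        - (dy H (s₀, t) * P (s, t) - dy H (s₀, t) * P (s₀, t))) := fun t => by ring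
  simp only [expand]
  rw [intervalIntegral.integral_const_mul, intervalIntegral.integral_sub (i1.sub i2) (i3.sub i4),
    intervalIntegral.integral_sub i1 i2, intervalIntegral.integral_sub i3 i4,
    parts s hs.1, slope_def_field, parts s₀ hs₀]
  ring

end Slices

section FluxBounds

variable {h g m k l j : ℝ → ℝ} {t₀ t₁ α M : ℝ}

/-- The flux is controlled by the energy on the slice, by Wirtinger's inequality. -/
theorem abs_integral_mul_le_of_wirtinger (h01 : t₀ ≤ t₁)
    (hg : ContinuousOn g (Icc t₀ t₁))
    (hm : ContinuousOn m (Icc t₀ t₁)) (hk : ContinuousOn k (Icc t₀ t₁))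
    (hl : ContinuousOn l (Icc t₀ t₁)) (hj : ContinuousOn j (Icc t₀ t₁)) (hα : 0 < α)
    (hW : ∫ t in t₀..t₁, g t ^ 2 ≤ ∫ t in t₀..t₁, (m t * l t) ^ 2)
    (hhg : ∀ t ∈ Icc t₀ t₁, |h t| ≤ |m t * g t|)
    (hJ : ∀ t ∈ Icc t₀ t₁, α * (m t ^ 2 * (k t ^ 2 + l t ^ 2)) ≤ j t) :
    2 * α * |∫ t in t₀..t₁, h t * k t| ≤ ∫ t in t₀..t₁, j t := by
  have ii : ∀ {f : ℝ → ℝ}, ContinuousOn f (Icc t₀ t₁) → IntervalIntegrable f volume t₀ t₁ :=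
    fun hf => ContinuousOn.intervalIntegrable (by rwa [uIcc_of_le h01])
  have iG : IntervalIntegrable (fun t => g t ^ 2) volume t₀ t₁ := ii (hg.pow 2)
  have iK : IntervalIntegrable (fun t => (m t * k t) ^ 2) volume t₀ t₁ := ii ((hm.mul hk).pow 2)
  have iL : IntervalIntegrable (fun t => (m t * l t) ^ 2) volume t₀ t₁ := ii ((hm.mul hl).pow 2)
  have a1 : |∫ t in t₀..t₁, h t * k t| ≤ ∫ t in t₀..t₁, (g t ^ 2 + (m t * k t) ^ 2) / 2 := by
    rw [← Real.norm_eq_abs]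
    refine intervalIntegral.norm_integral_le_of_norm_le h01 (Eventually.of_forall fun t ht => ?_)
      (ii (((hg.pow 2).add ((hm.mul hk).pow 2)).div_const 2))
    have e := hhg t (Ioc_subset_Icc_self ht)
    rw [Real.norm_eq_abs, abs_mul]
    calc |h t| * |k t| ≤ |m t * g t| * |k t| := by gcongr
      _ = |g t| * |m t * k t| := by rw [abs_mul, abs_mul]; ring
      _ ≤ _ := by
        have := two_mul_le_add_sq (|g t|) (|m t * k t|)
        rw [sq_abs, sq_abs] at this; linarith
  have a2 : ∫ t in t₀..t₁, (g t ^ 2 + (m t * k t) ^ 2) / 2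
      = ((∫ t in t₀..t₁, g t ^ 2) + ∫ t in t₀..t₁, (m t * k t) ^ 2) / 2 := by
    rw [intervalIntegral.integral_div, intervalIntegral.integral_add iG iK]
  have a3 : α * ((∫ t in t₀..t₁, (m t * l t) ^ 2) + ∫ t in t₀..t₁, (m t * k t) ^ 2)
      ≤ ∫ t in t₀..t₁, j t := by
    rw [← intervalIntegral.integral_add iL iK,
      ← intervalIntegral.integral_const_mul]
    refine intervalIntegral.integral_mono_on h01
      ((iL.add iK).const_mul α) (ii hj) ?_
    intro t ht
    have := hJ t ht
    nlinarith
  rw [a2] at a1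
  nlinarith

/-- The square of the flux is controlled by the energy on the slice and a bound for the second
component. -/
theorem sq_integral_mul_le (h01 : t₀ < t₁)
    (hj : ContinuousOn j (Icc t₀ t₁)) (hα : 0 < α) (hM : 0 < M)
    (hhg : ∀ t ∈ Icc t₀ t₁, |h t| ≤ M * |m t|)
    (hJ : ∀ t ∈ Icc t₀ t₁, α * (m t ^ 2 * (k t ^ 2 + l t ^ 2)) ≤ j t) :
    α / (M ^ 2 * (t₁ - t₀)) * (∫ t in t₀..t₁, h t * k t) ^ 2 ≤ ∫ t in t₀..t₁, j t := by
  have ii : ∀ {f : ℝ → ℝ}, ContinuousOn f (Icc t₀ t₁) → IntervalIntegrable f volume t₀ t₁ :=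
    fun hf => ContinuousOn.intervalIntegrable (by rwa [uIcc_of_le h01.le])
  set F := ∫ t in t₀..t₁, h t * k t
  have hlen : 0 < t₁ - t₀ := by linarith
  have hj0 : 0 ≤ ∫ t in t₀..t₁, j t := intervalIntegral.integral_nonneg h01.le fun t ht =>
    le_trans (by positivity) (hJ t ht)
  rcases eq_or_ne F 0 with h0 | h0
  · rw [h0]; simpa using hj0
  -- Young's inequality with the weight that makes the first term `|F| / 2`
  set lam := |F| / (M ^ 2 * (t₁ - t₀)) with hlam
  have hlam0 : 0 < lam := by have := abs_pos.2 h0; positivity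
  have a1 : |F| ≤ ∫ t in t₀..t₁, (lam * M ^ 2 / 2 + j t / (2 * α * lam)) := by
    rw [← Real.norm_eq_abs]
    refine intervalIntegral.norm_integral_le_of_norm_le h01.le
      (Eventually.of_forall fun t ht => ?_) (ii (continuousOn_const.add (hj.div_const _)))
    have e := hhg t (Ioc_subset_Icc_self ht)
    have e2 := hJ t (Ioc_subset_Icc_self ht)
    have e3 : (|m t| * |k t|) ^ 2 / lam ≤ j t / (α * lam) := by
      rw [div_le_div_iff₀ hlam0 (by positivity)]
      have : α * (|m t| * |k t|) ^ 2 ≤ j t := by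
        rw [mul_pow, sq_abs, sq_abs]
        refine le_trans ?_ e2
        gcongr
        nlinarith [sq_nonneg (l t)]
      nlinarith
    have e4 : 2 * (M * (|m t| * |k t|)) ≤ lam * M ^ 2 + (|m t| * |k t|) ^ 2 / lam := by
      have := sq_nonneg (lam * M - |m t| * |k t|)
      have h5 : lam * M ^ 2 + (|m t| * |k t|) ^ 2 / lam - 2 * (M * (|m t| * |k t|))
        = (lam * M - |m t| * |k t|) ^ 2 / lam := by field_simp; ring
      have : 0 ≤ (lam * M - |m t| * |k t|) ^ 2 / lam := by positivity
      linarith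
    rw [Real.norm_eq_abs, abs_mul]
    have e5 : j t / (2 * α * lam) = j t / (α * lam) / 2 := by field_simp
    rw [e5]
    have : |h t| * |k t| ≤ M * |m t| * |k t| := by gcongr
    nlinarith
  rw [intervalIntegral.integral_add (ii continuousOn_const) (ii (hj.div_const _)),
    intervalIntegral.integral_const, intervalIntegral.integral_div, smul_eq_mul] at a1
  have a2 : (t₁ - t₀) * (lam * M ^ 2 / 2) = |F| / 2 := by rw [hlam]; field_simp
  rw [a2] at a1
  have a3 : |F| / 2 ≤ (∫ t in t₀..t₁, j t) / (2 * α * lam) := by linarith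
  rw [le_div_iff₀ (by positivity)] at a3
  have a4 : α / (M ^ 2 * (t₁ - t₀)) * F ^ 2 = |F| / 2 * (2 * α * lam) := by
    rw [hlam, ← sq_abs F]; field_simp
  rw [a4]; exact a3

end FluxBounds

/-! ### Energy decay on half-cylinders -/

section Decay

variable {F j : ℝ → ℝ} {a b c : ℝ}

theorem lintegral_Ioi_le_exp_mul (hF : ∀ s, a < s → HasDerivAt F (-j s) s)
    (hbF : ∀ s, a < s → b * |F s| ≤ j s) (hcF : ∀ s, a < s → c * F s ^ 2 ≤ j s)
    (hb : 0 < b) (hc : 0 < c) {s t : ℝ} (hs : a < s) (hst : s ≤ t) :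
    ∫⁻ x in Ioi t, ENNReal.ofReal (j x) ≤
      ENNReal.ofReal (Real.exp (-(b * (t - s)))) * ∫⁻ x in Ioi s, ENNReal.ofReal (j x) := by
  rw [lintegral_Ioi_flux hF hbF hcF hb hc hs,
    lintegral_Ioi_flux hF hbF hcF hb hc (hs.trans_le hst), ← ENNReal.ofReal_mul (Real.exp_pos _).le]
  exact ENNReal.ofReal_le_ofReal (flux_exp_decay hF hbF hb hs hst)

theorem lintegral_Ioi_le_inv (hF : ∀ s, a < s → HasDerivAt F (-j s) s)
    (hbF : ∀ s, a < s → b * |F s| ≤ j s) (hcF : ∀ s, a < s → c * F s ^ 2 ≤ j s)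
    (hb : 0 < b) (hc : 0 < c) {s t : ℝ} (hs : a < s) (hst : s < t) :
    ∫⁻ x in Ioi t, ENNReal.ofReal (j x) ≤ ENNReal.ofReal (1 / (c * (t - s))) := by
  rw [lintegral_Ioi_flux hF hbF hcF hb hc (hs.trans hst)]
  exact ENNReal.ofReal_le_ofReal (flux_le hF hcF hc hs hst)

end Decay

section QCBasics

variable {K : ℝ} {P Q : ℝ × ℝ → ℝ} {U : Set (ℝ × ℝ)}

theorem QC.jac_nonneg (h : QC K P Q U) (hK : 1 ≤ K) {z : ℝ × ℝ} (hz : z ∈ U) : 0 ≤ jac P Q z := by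
  have := h.distortion z hz
  have h2 : 0 ≤ 2 * K * jac P Q z := le_trans (by positivity) this
  exact nonneg_of_mul_nonneg_right h2 (by linarith)

theorem QC.expo_mul_le (h : QC K P Q U) (hK : 1 ≤ K) {z : ℝ × ℝ} (hz : z ∈ U) :
    (K - √(K ^ 2 - 1)) * (dy P z ^ 2 + dy Q z ^ 2) ≤ jac P Q z :=
  expo_mul_le_jac hK (h.distortion z hz)

theorem fderiv_periodic {f : ℝ × ℝ → ℝ} {v : ℝ × ℝ} (hf : ∀ z, f (z + v) = f z) (z : ℝ × ℝ) :
    fderiv ℝ f (z + v) = fderiv ℝ f z := by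
  rw [← fderiv_comp_add_right]; congr 1; exact funext hf

/-- Opposite points of a circle at which a function takes the same value. -/
theorem exists_eq_add_pi {f : ℝ → ℝ} (hf : Continuous f) (hp : Function.Periodic f (2 * Real.pi)) :
    ∃ c, f (c + Real.pi) = f c := by
  have hu : Continuous fun t => f (t + Real.pi) - f t := by fun_prop
  have h0 : f (0 + Real.pi) - f 0 = -(f (-Real.pi + Real.pi) - f (-Real.pi)) := by
    have := hp (-Real.pi)
    rw [show -Real.pi + 2 * Real.pi = 0 + Real.pi by ring] at this
    rw [this, neg_add_cancel]; ring
  rcases le_total 0 (f (0 + Real.pi) - f 0) with h | h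
  · obtain ⟨c, hc⟩ := mem_range_of_exists_le_of_exists_ge hu ⟨-Real.pi, by linarith⟩ ⟨0, h⟩
    exact ⟨c, by linarith⟩
  · obtain ⟨c, hc⟩ := mem_range_of_exists_le_of_exists_ge hu ⟨0, h⟩ ⟨-Real.pi, by linarith⟩
    exact ⟨c, by linarith⟩

end QCBasics

section Periodic

variable {K : ℝ} {P Q : ℝ × ℝ → ℝ} {a M : ℝ}

/-- Wirtinger's inequality on a circle, with the mean value replaced by the common value at two
opposite points. -/
theorem exists_wirtinger_periodic {f f' : ℝ → ℝ} (hf : ∀ t, HasDerivAt f (f' t) t)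
    (hc : Continuous f') (hp : Function.Periodic f (2 * Real.pi)) :
    ∃ b v : ℝ, ∫ t in b..b + 2 * Real.pi, (f t - v) ^ 2 ≤ ∫ t in b..b + 2 * Real.pi, f' t ^ 2 := by
  have hfc : Continuous f := continuous_iff_continuousAt.2 fun t => (hf t).continuousAt
  obtain ⟨b, hb⟩ := exists_eq_add_pi hfc hp
  refine ⟨b, f b, ?_⟩
  have i1 : ∀ x y, IntervalIntegrable (fun t => (f t - f b) ^ 2) volume x y := fun x y =>
    (by fun_prop : Continuous fun t => (f t - f b) ^ 2).intervalIntegrable x y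
  have i2 : ∀ x y, IntervalIntegrable (fun t => f' t ^ 2) volume x y := fun x y =>
    (by fun_prop : Continuous fun t => f' t ^ 2).intervalIntegrable x y
  have hπ := Real.pi_pos
  rw [← intervalIntegral.integral_add_adjacent_intervals (i1 b (b + Real.pi)) (i1 _ _),
    ← intervalIntegral.integral_add_adjacent_intervals (i2 b (b + Real.pi)) (i2 _ _)]
  apply add_le_add
  · exact integral_sq_le_integral_deriv_sq (f := fun t => f t - f b) (by linarith) le_rfl
      (fun t _ => (hf t).sub_const _) hc.continuousOn (by simp) (by simp [hb])
  · exact integral_sq_le_integral_deriv_sq (f := fun t => f t - f b) (by linarith) (by linarith)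
      (fun t _ => (hf t).sub_const _) hc.continuousOn (by simp [hb]) (by simp [hp b])

/-- Energy decay on a half-cylinder, the logarithmic picture of a punctured disc. -/
theorem QC.lintegral_jac_cylinder_le (h : QC K P Q (Ioi a ×ˢ univ)) (hK : 1 ≤ K) (hM : 0 < M)
    (hQ : ∀ z ∈ Ioi a ×ˢ univ, |Q z| ≤ M) (hpP : ∀ z, P (z + (0, 2 * Real.pi)) = P z)
    (hpQ : ∀ z, Q (z + (0, 2 * Real.pi)) = Q z) {s t : ℝ} (hs : a < s) (hst : s ≤ t) :
    ∫⁻ z in Ioi t ×ˢ Ioc (-Real.pi) Real.pi, ENNReal.ofReal (jac P Q z) ≤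
      ENNReal.ofReal (Real.exp (-(2 * (K - √(K ^ 2 - 1)) * (t - s)))) *
        ∫⁻ z in Ioi s ×ˢ Ioc (-Real.pi) Real.pi, ENNReal.ofReal (jac P Q z) := by
  have hα := expo_pos hK
  set α := K - √(K ^ 2 - 1)
  have hU : IsOpen (Ioi a ×ˢ (univ : Set ℝ)) := isOpen_Ioi.prod isOpen_univ
  have hπ := Real.pi_pos
  have hP := h.contDiffOn_fst
  have hQd := h.contDiffOn_snd
  have mem : ∀ {x : ℝ}, a < x → ∀ t : ℝ, (x, t) ∈ Ioi a ×ˢ (univ : Set ℝ) := fun hx t =>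
    ⟨hx, mem_univ _⟩
  have cont : ∀ {g : ℝ × ℝ → ℝ}, ContinuousOn g (Ioi a ×ˢ univ) → ∀ x, a < x →
      Continuous fun t => g (x, t) := fun hg x hx => by
    rw [← continuousOn_univ]
    exact hg.comp (by fun_prop) fun t _ => mem hx t
  have cJ := continuousOn_jac hU hP hQd
  have cPy := continuousOn_dy hU hP
  have cQy := continuousOn_dy hU hQd
  have per : ∀ {g : ℝ × ℝ → ℝ}, (∀ z, g (z + (0, 2 * Real.pi)) = g z) → ∀ x,
      Function.Periodic (fun t => g (x, t)) (2 * Real.pi) := fun hg x t => by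
    simpa using hg (x, t)
  have pPy : ∀ z, dy P (z + (0, 2 * Real.pi)) = dy P z := fun z => by
    unfold dy; rw [fderiv_periodic hpP]
  have pQy : ∀ z, dy Q (z + (0, 2 * Real.pi)) = dy Q z := fun z => by
    unfold dy; rw [fderiv_periodic hpQ]
  have pJ : ∀ z, jac P Q (z + (0, 2 * Real.pi)) = jac P Q z := fun z => by
    unfold jac dx dy; rw [fderiv_periodic hpQ, fderiv_periodic hpP]
  set F : ℝ → ℝ := fun s => ∫ t in -Real.pi..Real.pi, Q (s, t) * dy P (s, t) with hFdef
  set j : ℝ → ℝ := fun s => ∫ t in -Real.pi..Real.pi, jac P Q (s, t) with hjdef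
  have hF : ∀ s, a < s → HasDerivAt F (-j s) s := by
    intro s hs
    have := hasDerivAt_integral_mul_dy (t₀ := -Real.pi) (t₁ := Real.pi) (s₀ := s)
      (r := (s - a) / 2) hU hQd hP (by linarith) (by linarith)
      (fun z hz => mem (by have := hz.1.1; linarith) z.2) (fun x _ y _ => by
        have e1 := per hpQ x (-Real.pi)
        have e2 := per hpP y (-Real.pi)
        simp only [show -Real.pi + 2 * Real.pi = Real.pi by ring] at e1 e2
        rw [e1, e2])
    refine this.congr_deriv ?_
    rw [hjdef, ← intervalIntegral.integral_neg]
    congr 1; ext t; unfold jac; ring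
  have hbF : ∀ s, a < s → 2 * α * |F s| ≤ j s := by
    intro s hs
    obtain ⟨b, v, hbv⟩ := exists_wirtinger_periodic
      (fun t => hasDerivAt_snd_slice hU hQd (mem hs t)) (cont cQy s hs) (per hpQ s)
    have shift : ∀ {g : ℝ × ℝ → ℝ}, (∀ z, g (z + (0, 2 * Real.pi)) = g z) →
        ∫ t in -Real.pi..Real.pi, g (s, t) = ∫ t in b..b + 2 * Real.pi, g (s, t) := fun hg => by
      have := (per hg s).intervalIntegral_add_eq (-Real.pi) b
      rwa [show -Real.pi + 2 * Real.pi = Real.pi by ring] at this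
    -- the flux is unchanged when a constant is subtracted from `Q`
    have e1 : F s = ∫ t in b..b + 2 * Real.pi, (Q (s, t) - v) * dy P (s, t) := by
      have e0 : F s = ∫ t in b..b + 2 * Real.pi, Q (s, t) * dy P (s, t) :=
        shift (g := fun z => Q z * dy P z) (fun z => by simp only [hpQ, pPy])
      have e2 : ∫ t in b..b + 2 * Real.pi, dy P (s, t) = 0 := by
        rw [intervalIntegral.integral_eq_sub_of_hasDerivAt
          (fun t _ => hasDerivAt_snd_slice hU hP (mem hs t))
          ((cont cPy s hs).intervalIntegrable _ _)]
        rw [sub_eq_zero]; exact per hpP s b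
      have i1 : IntervalIntegrable (fun t => Q (s, t) * dy P (s, t)) volume b (b + 2 * Real.pi) :=
        ((cont hQd.continuousOn s hs).mul (cont cPy s hs)).intervalIntegrable _ _
      simp only [sub_mul]
      rw [intervalIntegral.integral_sub i1
        (((cont cPy s hs).const_mul v).intervalIntegrable _ _),
        intervalIntegral.integral_const_mul, e2, e0]; ring
    rw [e1, hjdef]
    simp only
    rw [shift pJ]
    refine abs_integral_mul_le_of_wirtinger (g := fun t => Q (s, t) - v) (m := fun _ => 1)
      (l := fun t => dy Q (s, t)) (by linarith)
      ((cont hQd.continuousOn s hs).sub continuous_const).continuousOn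
      continuousOn_const (cont cPy s hs).continuousOn (cont cQy s hs).continuousOn
      (cont cJ s hs).continuousOn hα (by simpa using hbv) (fun t _ => by simp) (fun t _ => ?_)
    simpa using h.expo_mul_le hK (mem hs t)
  have hcF : ∀ s, a < s → α / (M ^ 2 * (Real.pi - -Real.pi)) * F s ^ 2 ≤ j s := by
    intro s hs
    refine sq_integral_mul_le (h := fun t => Q (s, t)) (m := fun _ => 1)
      (l := fun t => dy Q (s, t)) (by linarith) (cont cJ s hs).continuousOn hα hM
      (fun t _ => by simpa using hQ _ (mem hs t)) (fun t _ => ?_)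
    simpa using h.expo_mul_le hK (mem hs t)
  have hI : ∀ s, a < s → ∫⁻ z in Ioi s ×ˢ Ioc (-Real.pi) Real.pi, ENNReal.ofReal (jac P Q z)
      = ∫⁻ x in Ioi s, ENNReal.ofReal (j x) := by
    intro s hs
    rw [Measure.volume_eq_prod, setLIntegral_prod _ measurable_jac.ennreal_ofReal.aemeasurable]
    refine setLIntegral_congr_fun measurableSet_Ioi fun x hx => ?_
    have hx' : a < x := hs.trans hx
    simp only [hjdef]
    rw [intervalIntegral.integral_of_le (by linarith), ofReal_integral_eq_lintegral_ofReal]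
    · exact ((cont cJ x hx').intervalIntegrable (μ := volume) (-Real.pi) Real.pi).1
    · exact Eventually.of_forall fun t => h.jac_nonneg hK (mem hx' t)
  rw [hI s hs, hI t (hs.trans_le hst)]
  have hden : 0 < M ^ 2 * (Real.pi - -Real.pi) := mul_pos (by positivity) (by linarith)
  exact lintegral_Ioi_le_exp_mul hF hbF hcF (by linarith) (by positivity) hs hst

end Periodic

/-! ### Truncation and the zero set of the second component -/

section Truncation

/-- A continuous even weight with values in `[0, 1]`, nondecreasing in `|t|`, which vanishes for
`|t| ≤ δ` and equals `1` for `|t| ≥ 2 δ`. -/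
noncomputable def cutoff (δ t : ℝ) : ℝ := min (max (|t| / δ - 1) 0) 1

variable {δ : ℝ}

theorem continuous_cutoff : Continuous (cutoff δ) := by unfold cutoff; fun_prop

theorem cutoff_nonneg (t : ℝ) : 0 ≤ cutoff δ t := le_min (le_max_right _ _) zero_le_one

theorem cutoff_le_one (t : ℝ) : cutoff δ t ≤ 1 := min_le_right _ _

theorem cutoff_eq_zero (hδ : 0 < δ) {t : ℝ} (ht : |t| ≤ δ) : cutoff δ t = 0 := by
  unfold cutoff
  rw [max_eq_right (by rw [sub_nonpos, div_le_one hδ]; exact ht)]; simp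

theorem cutoff_eq_one (hδ : 0 < δ) {t : ℝ} (ht : 2 * δ ≤ |t|) : cutoff δ t = 1 := by
  unfold cutoff
  have : 1 ≤ |t| / δ - 1 := by
    rw [le_sub_iff_add_le, le_div_iff₀ hδ]; linarith
  exact min_eq_right (this.trans (le_max_left _ _))

theorem cutoff_mono (hδ : 0 < δ) {s t : ℝ} (h : |s| ≤ |t|) : cutoff δ s ≤ cutoff δ t := by
  unfold cutoff; gcongr

/-- The truncated identity: the primitive of the squared weight. -/
noncomputable def trunc (δ t : ℝ) : ℝ := ∫ x in (0 : ℝ)..t, cutoff δ x ^ 2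

/-- The primitive of the weight. -/
noncomputable def truncRoot (δ t : ℝ) : ℝ := ∫ x in (0 : ℝ)..t, cutoff δ x

theorem hasDerivAt_trunc (t : ℝ) : HasDerivAt (trunc δ) (cutoff δ t ^ 2) t :=
  (continuous_cutoff.pow 2).integral_hasStrictDerivAt 0 t |>.hasDerivAt

theorem hasDerivAt_truncRoot (t : ℝ) : HasDerivAt (truncRoot δ) (cutoff δ t) t :=
  continuous_cutoff.integral_hasStrictDerivAt 0 t |>.hasDerivAt

theorem contDiff_trunc : ContDiff ℝ 1 (trunc δ) := by
  rw [contDiff_one_iff_deriv]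
  refine ⟨fun t => (hasDerivAt_trunc t).differentiableAt, ?_⟩
  rw [show deriv (trunc δ) = fun t => cutoff δ t ^ 2 from funext fun t => (hasDerivAt_trunc t).deriv]
  exact continuous_cutoff.pow 2

theorem truncRoot_eq_zero (hδ : 0 < δ) {t : ℝ} (ht : |t| ≤ δ) : truncRoot δ t = 0 := by
  unfold truncRoot
  refine intervalIntegral.integral_zero_ae (Eventually.of_forall fun x hx => ?_)
  have := abs_sub_left_of_mem_uIcc (uIoc_subset_uIcc hx)
  exact cutoff_eq_zero hδ (by simp only [sub_zero] at this; exact this.trans ht)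

theorem abs_truncRoot_le (t : ℝ) : |truncRoot δ t| ≤ |t| := by
  have := intervalIntegral.norm_integral_le_of_norm_le_const (a := 0) (b := t) (f := cutoff δ) (C := 1)
    (fun x _ => by rw [Real.norm_eq_abs, abs_of_nonneg (cutoff_nonneg x)]; exact cutoff_le_one x)
  simpa [truncRoot] using this

/-- The weight is nondecreasing, so it can be pulled out of the integral defining `trunc`. -/
theorem abs_trunc_le (hδ : 0 < δ) (t : ℝ) : |trunc δ t| ≤ |cutoff δ t * truncRoot δ t| := by
  have hc := continuous_cutoff (δ := δ)
  have key : ∀ x y : ℝ, x ≤ y → (∀ z ∈ Icc x y, cutoff δ z ≤ cutoff δ t) →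
      |∫ z in x..y, cutoff δ z ^ 2| ≤ |cutoff δ t * ∫ z in x..y, cutoff δ z| := by
    intro x y hxy hz
    rw [← intervalIntegral.integral_const_mul]
    refine abs_le_abs_of_nonneg
      (intervalIntegral.integral_nonneg hxy fun z _ => by positivity)
      (intervalIntegral.integral_mono_on hxy ((hc.pow 2).intervalIntegrable _ _)
        ((hc.const_mul _).intervalIntegrable _ _) fun z hz' => ?_)
    rw [pow_two]
    exact mul_le_mul_of_nonneg_right (hz z hz') (cutoff_nonneg z)
  unfold trunc truncRoot
  rcases le_total 0 t with ht | ht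
  · refine key 0 t ht fun z hz => cutoff_mono hδ ?_
    rw [abs_of_nonneg hz.1, abs_of_nonneg ht]; exact hz.2
  · rw [intervalIntegral.integral_symm, intervalIntegral.integral_symm t, mul_neg, abs_neg, abs_neg]
    refine key t 0 ht fun z hz => cutoff_mono hδ ?_
    rw [abs_of_nonpos hz.2, abs_of_nonpos ht]; linarith [hz.1]

theorem trunc_eq_zero (hδ : 0 < δ) {t : ℝ} (ht : |t| ≤ δ) : trunc δ t = 0 := by
  have := abs_trunc_le hδ t
  rw [truncRoot_eq_zero hδ ht, mul_zero, abs_zero] at this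
  exact abs_nonpos_iff.1 this

theorem tendsto_cutoff {t : ℝ} (ht : t ≠ 0) :
    Tendsto (fun n : ℕ => cutoff (1 / ((n : ℝ) + 1)) t) atTop (𝓝 1) := by
  have h0 := tendsto_one_div_add_atTop_nhds_zero_nat (𝕜 := ℝ)
  have h1 : ∀ᶠ n : ℕ in atTop, 1 / ((n : ℝ) + 1) < |t| / 2 :=
    h0.eventually_lt_const (by have := abs_pos.2 ht; positivity)
  refine tendsto_const_nhds.congr' ?_
  filter_upwards [h1] with n hn
  exact (cutoff_eq_one (by positivity) (by linarith)).symm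

end Truncation

section NullSet

variable {f P Q : ℝ × ℝ → ℝ} {U : Set (ℝ × ℝ)}

theorem countable_simple_zeros {f f' : ℝ → ℝ} {S : Set ℝ} (hS : ∀ x ∈ S, HasDerivAt f (f' x) x)
    (h0 : ∀ x ∈ S, f x = 0) (h1 : ∀ x ∈ S, f' x ≠ 0) : S.Countable := by
  refine (countable_setOfPred_isolated_right_within (s := S)).mono fun x hx => ?_
  change x ∈ S ∧ 𝓝[S ∩ Ioi x] x = ⊥
  refine ⟨hx, ?_⟩
  have h := (hS x hx).eventually_ne (h1 x hx) (c := 0)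
  rw [← Filter.empty_mem_iff_bot]
  have h2 : ∀ᶠ z in 𝓝[S ∩ Ioi x] x, f z ≠ 0 :=
    h.filter_mono (nhdsWithin_mono x fun z hz => ne_of_gt hz.2)
  filter_upwards [h2, self_mem_nhdsWithin] with z hz hz2
  exact hz (h0 z hz2.1)

/-- On the zero set of `Q` the Jacobian vanishes almost everywhere, since the points where a
partial derivative of `Q` does not vanish form countable slices. -/
theorem ae_jac_eq_zero_of_eq_zero (hU : IsOpen U) (hQ : ContDiffOn ℝ 1 Q U) :
    ∀ᵐ z ∂(volume.restrict U), Q z = 0 → jac P Q z = 0 := by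
  have hZ : MeasurableSet (U ∩ Q ⁻¹' {0}) := by
    have h1 : IsOpen (U ∩ Q ⁻¹' {0}ᶜ) :=
      hQ.continuousOn.isOpen_inter_preimage hU isOpen_compl_singleton
    have : U ∩ Q ⁻¹' {0} = U \ (U ∩ Q ⁻¹' {0}ᶜ) := by ext z; simp
    rw [this]; exact hU.measurableSet.diff h1.measurableSet
  have hmx : Measurable (dx Q) := measurable_fderiv_apply_const ℝ Q _
  have hmy : Measurable (dy Q) := measurable_fderiv_apply_const ℝ Q _
  have nx : volume ((U ∩ Q ⁻¹' {0}) ∩ dx Q ⁻¹' {0}ᶜ) = 0 := by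
    have hms : MeasurableSet ((U ∩ Q ⁻¹' {0}) ∩ dx Q ⁻¹' {0}ᶜ) :=
      hZ.inter (hmx (measurableSet_singleton 0).compl)
    rw [Measure.volume_eq_prod, Measure.prod_apply_symm hms]
    refine lintegral_eq_zero_of_ae_eq_zero (Eventually.of_forall fun t => ?_)
    refine (countable_simple_zeros (f := fun s => Q (s, t)) (f' := fun s => dx Q (s, t))
      ?_ ?_ ?_).measure_zero _
    · exact fun s hs => hasDerivAt_fst_slice hU hQ hs.1.1
    · exact fun s hs => hs.1.2
    · exact fun s hs => hs.2
  have ny : volume ((U ∩ Q ⁻¹' {0}) ∩ dy Q ⁻¹' {0}ᶜ) = 0 := by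
    have hms : MeasurableSet ((U ∩ Q ⁻¹' {0}) ∩ dy Q ⁻¹' {0}ᶜ) :=
      hZ.inter (hmy (measurableSet_singleton 0).compl)
    rw [Measure.volume_eq_prod, Measure.measure_prod_null hms]
    refine Eventually.of_forall fun x => ?_
    refine (countable_simple_zeros (f := fun t => Q (x, t)) (f' := fun t => dy Q (x, t))
      ?_ ?_ ?_).measure_zero _
    · exact fun t ht => hasDerivAt_snd_slice hU hQ ht.1.1
    · exact fun t ht => ht.1.2
    · exact fun t ht => ht.2
  rw [ae_restrict_iff' hU.measurableSet]
  have hx := measure_eq_zero_iff_ae_notMem.1 nx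
  have hy := measure_eq_zero_iff_ae_notMem.1 ny
  filter_upwards [hx, hy] with z h1 h2 hz h0
  have e1 : dx Q z = 0 := by by_contra hne; exact h1 ⟨⟨hz, h0⟩, hne⟩
  have e2 : dy Q z = 0 := by by_contra hne; exact h2 ⟨⟨hz, h0⟩, hne⟩
  simp [jac, e1, e2]

end NullSet

/-! ### Energy decay on half-strips -/

section Strip

variable {K : ℝ} {P Q : ℝ × ℝ → ℝ} {a M δ : ℝ}

/-- A slice integral over `(0, π)` of a function that vanishes near the end points. -/
theorem setIntegral_Ioo_eq_intervalIntegral {f : ℝ → ℝ} {e : ℝ} (he : 0 < e) (he2 : e < Real.pi / 2)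
    (hf : ∀ t ∈ Ioo 0 Real.pi, (t ≤ e ∨ Real.pi - e ≤ t) → f t = 0) :
    ∫ t in Ioo 0 Real.pi, f t = ∫ t in e..Real.pi - e, f t := by
  rw [intervalIntegral.integral_of_le (by linarith)]
  apply setIntegral_eq_of_subset_of_forall_sdiff_eq_zero measurableSet_Ioo
  · exact fun t ht => ⟨he.trans ht.1, ht.2.trans_lt (by linarith)⟩
  · intro t ht
    refine hf t ht.1 ?_
    by_contra! hc
    exact ht.2 ⟨hc.1, hc.2.le⟩

/-- Flux estimates for the truncated function `trunc δ ∘ Q`, whose support stays away from the two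
boundary lines of the half-strip, where nothing is known about the derivatives of `P` and `Q`. -/
theorem QC.strip_flux (h : QC K P Q (Ioi a ×ˢ Ioo 0 Real.pi)) (hK : 1 ≤ K) (hM : 0 < M)
    (hδ : 0 < δ) (hQ : ∀ z ∈ Ioi a ×ˢ Ioo 0 Real.pi, |Q z| ≤ M) {s e : ℝ} (he : 0 < e)
    (he2 : e < Real.pi / 2) (hs : a + e < s)
    (hbd : ∀ x ∈ Icc (s - e) (s + e), ∀ t ∈ Ioo 0 Real.pi, (t ≤ e ∨ Real.pi - e ≤ t) →
      |Q (x, t)| ≤ δ) :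
    let α := K - √(K ^ 2 - 1)
    let F := fun x => ∫ t in Ioo 0 Real.pi, trunc δ (Q (x, t)) * dy P (x, t)
    let j := ∫ t in Ioo 0 Real.pi, cutoff δ (Q (s, t)) ^ 2 * jac P Q (s, t)
    HasDerivAt F (-j) s ∧ 2 * α * |F s| ≤ j ∧ α / (M ^ 2 * Real.pi) * F s ^ 2 ≤ j ∧
      IntegrableOn (fun t => cutoff δ (Q (s, t)) ^ 2 * jac P Q (s, t)) (Ioo 0 Real.pi) := by
  intro α F j
  have hα : 0 < α := expo_pos hK
  have hU : IsOpen (Ioi a ×ˢ Ioo 0 Real.pi) := isOpen_Ioi.prod isOpen_Ioo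
  have hP := h.contDiffOn_fst
  have hQd := h.contDiffOn_snd
  have hle : e ≤ Real.pi - e := by linarith
  have mem : ∀ x ∈ Icc (s - e) (s + e), ∀ t ∈ Icc e (Real.pi - e),
      (x, t) ∈ Ioi a ×ˢ Ioo 0 Real.pi := fun x hx t ht =>
    ⟨show a < x by linarith [hx.1], he.trans_le ht.1, ht.2.trans_lt (by linarith)⟩
  have hs' : s ∈ Icc (s - e) (s + e) := ⟨by linarith, by linarith⟩
  have hend : ∀ x ∈ Icc (s - e) (s + e), |Q (x, e)| ≤ δ ∧ |Q (x, Real.pi - e)| ≤ δ := fun x hx =>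
    ⟨hbd x hx _ ⟨he, by linarith⟩ (Or.inl le_rfl),
      hbd x hx _ ⟨by linarith, by linarith⟩ (Or.inr le_rfl)⟩
  have hH : ContDiffOn ℝ 1 (fun z => trunc δ (Q z)) (Ioi a ×ˢ Ioo 0 Real.pi) :=
    contDiff_trunc.comp_contDiffOn hQd
  have cJ := continuousOn_jac hU hP hQd
  have cPy := continuousOn_dy hU hP
  have cQy := continuousOn_dy hU hQd
  have cm : ContinuousOn (fun z => cutoff δ (Q z)) (Ioi a ×ˢ Ioo 0 Real.pi) :=
    continuous_cutoff.comp_continuousOn hQd.continuousOn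
  have cg : ContinuousOn (fun z => truncRoot δ (Q z)) (Ioi a ×ˢ Ioo 0 Real.pi) :=
    (continuous_iff_continuousAt.2 fun t => (hasDerivAt_truncRoot t).continuousAt).comp_continuousOn
      hQd.continuousOn
  have sl : ∀ {g : ℝ × ℝ → ℝ}, ContinuousOn g (Ioi a ×ˢ Ioo 0 Real.pi) →
      ContinuousOn (fun t => g (s, t)) (Icc e (Real.pi - e)) := fun hg =>
    continuousOn_slice hg (mem s hs')
  have hFeq : ∀ x ∈ Icc (s - e) (s + e),
      F x = ∫ t in e..Real.pi - e, trunc δ (Q (x, t)) * dy P (x, t) := fun x hx =>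
    setIntegral_Ioo_eq_intervalIntegral he he2 fun t ht hte => by
      rw [trunc_eq_zero hδ (hbd x hx t ht hte), zero_mul]
  have hj0 : ∀ t ∈ Ioo 0 Real.pi, (t ≤ e ∨ Real.pi - e ≤ t) →
      cutoff δ (Q (s, t)) ^ 2 * jac P Q (s, t) = 0 := fun t ht hte => by
    rw [cutoff_eq_zero hδ (hbd s hs' t ht hte)]; ring
  have hjeq : j = ∫ t in e..Real.pi - e, cutoff δ (Q (s, t)) ^ 2 * jac P Q (s, t) :=
    setIntegral_Ioo_eq_intervalIntegral he he2 hj0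
  have cj : ContinuousOn (fun t => cutoff δ (Q (s, t)) ^ 2 * jac P Q (s, t))
      (Icc e (Real.pi - e)) := sl ((cm.pow 2).mul cJ)
  have hJα : ∀ t ∈ Icc e (Real.pi - e), α * (cutoff δ (Q (s, t)) ^ 2 *
      (dy P (s, t) ^ 2 + dy Q (s, t) ^ 2)) ≤ cutoff δ (Q (s, t)) ^ 2 * jac P Q (s, t) := by
    intro t ht
    have := mul_le_mul_of_nonneg_left (h.expo_mul_le hK (mem s hs' t ht))
      (sq_nonneg (cutoff δ (Q (s, t))))
    linarith
  refine ⟨?_, ?_, ?_, ?_⟩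
  · have hd := hasDerivAt_integral_mul_dy (s₀ := s) hU hH hP he hle
      (fun z hz => mem z.1 hz.1 z.2 hz.2) (fun x hx y _ => by
        simp only [trunc_eq_zero hδ (hend x hx).1, trunc_eq_zero hδ (hend x hx).2, zero_mul])
    refine (hd.congr_of_eventuallyEq ?_).congr_deriv ?_
    · filter_upwards [Icc_mem_nhds (by linarith : s - e < s) (by linarith : s < s + e)] with x hx
        using hFeq x hx
    · rw [hjeq, ← intervalIntegral.integral_neg]
      refine intervalIntegral.integral_congr fun t ht => ?_
      rw [uIcc_of_le hle] at ht
      rw [dx_comp hU hQd (mem s hs' t ht) (hasDerivAt_trunc _),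
        dy_comp hU hQd (mem s hs' t ht) (hasDerivAt_trunc _)]
      unfold jac; ring
  · rw [hFeq s hs', hjeq]
    refine abs_integral_mul_le_of_wirtinger (g := fun t => truncRoot δ (Q (s, t)))
      (m := fun t => cutoff δ (Q (s, t))) (l := fun t => dy Q (s, t)) hle (sl cg) (sl cm) (sl cPy)
      (sl cQy) cj hα ?_ (fun t _ => abs_trunc_le hδ _) hJα
    refine integral_sq_le_integral_deriv_sq hle (by linarith) (fun t ht => ?_)
      ((sl cm).mul (sl cQy)) (truncRoot_eq_zero hδ (hend s hs').1)
      (truncRoot_eq_zero hδ (hend s hs').2)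
    exact (hasDerivAt_truncRoot _).comp t (hasDerivAt_snd_slice hU hQd (mem s hs' t ht))
  · rw [hFeq s hs', hjeq]
    have key := sq_integral_mul_le (h := fun t => trunc δ (Q (s, t))) (k := fun t => dy P (s, t))
      (m := fun t => cutoff δ (Q (s, t)))
      (l := fun t => dy Q (s, t)) (by linarith : e < Real.pi - e) cj hα hM (fun t ht => ?_) hJα
    · refine le_trans ?_ key
      have : 0 < Real.pi - e - e := by linarith
      gcongr
      linarith
    · refine (abs_trunc_le hδ _).trans ?_
      rw [abs_mul, mul_comm]
      gcongr
      exact (abs_truncRoot_le _).trans (hQ _ (mem s hs' t ht))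
  · refine IntegrableOn.of_forall_sdiff_eq_zero (s := Icc e (Real.pi - e))
      cj.integrableOn_Icc measurableSet_Ioo fun t ht => hj0 t ht.1 ?_
    by_contra! hc
    exact ht.2 ⟨hc.1.le, hc.2.le⟩

/-- Energy decay on a half-strip, the logarithmic picture of a half-disc or of the complement of
one, when `Q` vanishes on the boundary lines. -/
theorem QC.lintegral_jac_strip_le (h : QC K P Q (Ioi a ×ˢ Ioo 0 Real.pi)) (hK : 1 ≤ K) (hM : 0 < M)
    (hQ : ∀ z ∈ Ioi a ×ˢ Ioo 0 Real.pi, |Q z| ≤ M)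
    (hbd : ∀ s, a < s → ∀ δ, 0 < δ → ∃ e, 0 < e ∧ ∀ x ∈ Icc (s - e) (s + e), ∀ t ∈ Ioo 0 Real.pi,
      (t ≤ e ∨ Real.pi - e ≤ t) → |Q (x, t)| ≤ δ) {s t : ℝ} (hs : a < s) :
    (s ≤ t → ∫⁻ z in Ioi t ×ˢ Ioo 0 Real.pi, ENNReal.ofReal (jac P Q z) ≤
      ENNReal.ofReal (Real.exp (-(2 * (K - √(K ^ 2 - 1)) * (t - s)))) *
        ∫⁻ z in Ioi s ×ˢ Ioo 0 Real.pi, ENNReal.ofReal (jac P Q z)) ∧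
    (s < t → ∫⁻ z in Ioi t ×ˢ Ioo 0 Real.pi, ENNReal.ofReal (jac P Q z) ≤
      ENNReal.ofReal (1 / ((K - √(K ^ 2 - 1)) / (M ^ 2 * Real.pi) * (t - s)))) := by
  have hα := expo_pos hK
  have hπ := Real.pi_pos
  have hU : IsOpen (Ioi a ×ˢ Ioo 0 Real.pi) := isOpen_Ioi.prod isOpen_Ioo
  -- the truncated energy, which increases to the energy as `δ` tends to zero
  set I : ℝ → ℝ → ENNReal := fun δ s => ∫⁻ z in Ioi s ×ˢ Ioo 0 Real.pi,
    ENNReal.ofReal (cutoff δ (Q z) ^ 2 * jac P Q z) with hI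
  have hsub : ∀ {x}, a < x → Ioi x ×ˢ Ioo 0 Real.pi ⊆ Ioi a ×ˢ Ioo 0 Real.pi := fun hx z hz =>
    ⟨hx.trans hz.1, hz.2⟩
  have hms : ∀ x : ℝ, MeasurableSet (Ioi x ×ˢ Ioo 0 Real.pi) := fun x =>
    measurableSet_Ioi.prod measurableSet_Ioo
  have hmeas : ∀ δ x, a < x → AEMeasurable
      (fun z => ENNReal.ofReal (cutoff δ (Q z) ^ 2 * jac P Q z))
      (volume.restrict (Ioi x ×ˢ Ioo 0 Real.pi)) := by
    intro δ x hx
    refine (ContinuousOn.aemeasurable ?_ (hms x)).ennreal_ofReal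
    exact (((continuous_cutoff.comp_continuousOn h.contDiffOn_snd.continuousOn).pow 2).mul
      (continuousOn_jac hU h.contDiffOn_fst h.contDiffOn_snd)).mono (hsub hx)
  have hflux : ∀ δ, 0 < δ → ∀ s, a < s → ∃ e, 0 < e ∧ e < Real.pi / 2 ∧ a + e < s ∧
      ∀ x ∈ Icc (s - e) (s + e), ∀ t ∈ Ioo 0 Real.pi, (t ≤ e ∨ Real.pi - e ≤ t) →
      |Q (x, t)| ≤ δ := by
    intro δ hδ s hs
    obtain ⟨e, he, hb⟩ := hbd s hs δ hδ
    refine ⟨min e (min (Real.pi / 4) ((s - a) / 2)), ?_, ?_, ?_, ?_⟩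
    · exact lt_min he (lt_min (by positivity) (by linarith))
    · exact ((min_le_right _ _).trans (min_le_left _ _)).trans_lt (by linarith)
    · have := (min_le_right e _).trans (min_le_right (Real.pi / 4) ((s - a) / 2))
      linarith
    · have hle := min_le_left e (min (Real.pi / 4) ((s - a) / 2))
      intro x hx t ht hte
      refine hb x ⟨by linarith [hx.1], by linarith [hx.2]⟩ t ht ?_
      rcases hte with hte | hte
      · left; linarith
      · right; linarith
  have hIeq : ∀ δ, 0 < δ → ∀ s, a < s → I δ s = ∫⁻ x in Ioi s, ENNReal.ofReal
      (∫ t in Ioo 0 Real.pi, cutoff δ (Q (x, t)) ^ 2 * jac P Q (x, t)) := by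
    intro δ hδ s hs
    have hm := hmeas δ s hs
    simp only [hI]
    rw [Measure.volume_eq_prod] at hm ⊢
    rw [setLIntegral_prod _ hm]
    refine setLIntegral_congr_fun measurableSet_Ioi fun x hx => ?_
    have hx' : a < x := hs.trans hx
    obtain ⟨e, he, he2, hes, hb⟩ := hflux δ hδ x hx'
    refine (ofReal_integral_eq_lintegral_ofReal
      (h.strip_flux hK hM hδ hQ he he2 hes hb).2.2.2 ?_).symm
    filter_upwards [ae_restrict_mem measurableSet_Ioo] with t ht
    exact mul_nonneg (sq_nonneg _) (h.jac_nonneg hK ⟨hx', ht⟩)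
  have hIle : ∀ δ s, a < s → I δ s ≤ ∫⁻ z in Ioi s ×ˢ Ioo 0 Real.pi, ENNReal.ofReal (jac P Q z) := by
    intro δ s hs
    refine setLIntegral_mono' (hms s) fun z hz => ENNReal.ofReal_le_ofReal ?_
    have h1 := h.jac_nonneg hK (hsub hs hz)
    have h2 : cutoff δ (Q z) ^ 2 ≤ 1 := pow_le_one₀ (cutoff_nonneg _) (cutoff_le_one _)
    nlinarith
  have hlim : ∀ t, a < t → ∀ B, (∀ δ, 0 < δ → I δ t ≤ B) →
      ∫⁻ z in Ioi t ×ˢ Ioo 0 Real.pi, ENNReal.ofReal (jac P Q z) ≤ B := by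
    intro t ht B hB
    have hae : ∀ᵐ z ∂(volume.restrict (Ioi t ×ˢ Ioo 0 Real.pi)), ENNReal.ofReal (jac P Q z)
        ≤ liminf (fun n : ℕ => ENNReal.ofReal (cutoff (1 / ((n : ℝ) + 1)) (Q z) ^ 2 * jac P Q z))
          atTop := by
      have := ae_restrict_of_ae_restrict_of_subset (hsub ht)
        (ae_jac_eq_zero_of_eq_zero (P := P) hU h.contDiffOn_snd)
      filter_upwards [this] with z hz
      rcases eq_or_ne (Q z) 0 with h0 | h0
      · rw [hz h0]; simp
      · have h1 := ((tendsto_cutoff h0).pow 2).mul_const (jac P Q z)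
        rw [one_pow, one_mul] at h1
        exact (ENNReal.tendsto_ofReal h1).liminf_eq.ge
    refine (lintegral_mono_ae hae).trans ((lintegral_liminf_le' fun n => hmeas _ t ht).trans ?_)
    exact liminf_le_of_le (by isBoundedDefault) fun b hb => by
      obtain ⟨n, hn⟩ := hb.exists
      exact hn.trans (hB _ (by positivity))
  have hF : ∀ δ : ℝ, 0 < δ → ∀ s, a < s →
      HasDerivAt (fun x => ∫ t in Ioo 0 Real.pi, trunc δ (Q (x, t)) * dy P (x, t))
        (-∫ t in Ioo 0 Real.pi, cutoff δ (Q (s, t)) ^ 2 * jac P Q (s, t)) s ∧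
      2 * (K - √(K ^ 2 - 1)) * |∫ t in Ioo 0 Real.pi, trunc δ (Q (s, t)) * dy P (s, t)|
        ≤ ∫ t in Ioo 0 Real.pi, cutoff δ (Q (s, t)) ^ 2 * jac P Q (s, t) ∧
      (K - √(K ^ 2 - 1)) / (M ^ 2 * Real.pi) *
        (∫ t in Ioo 0 Real.pi, trunc δ (Q (s, t)) * dy P (s, t)) ^ 2
        ≤ ∫ t in Ioo 0 Real.pi, cutoff δ (Q (s, t)) ^ 2 * jac P Q (s, t) := fun δ hδ s hs => by
    obtain ⟨e, he, he2, hes, hb⟩ := hflux δ hδ s hs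
    have key := h.strip_flux hK hM hδ hQ he he2 hes hb
    exact ⟨key.1, key.2.1, key.2.2.1⟩
  refine ⟨fun hst => ?_, fun hst => ?_⟩
  · refine hlim t (hs.trans_le hst) _ fun δ hδ => ?_
    have := lintegral_Ioi_le_exp_mul (fun s hs => (hF δ hδ s hs).1)
      (fun s hs => (hF δ hδ s hs).2.1) (fun s hs => (hF δ hδ s hs).2.2) (by positivity)
      (by positivity) hs hst
    rw [← hIeq δ hδ t (hs.trans_le hst), ← hIeq δ hδ s hs] at this
    exact this.trans (mul_le_mul_right (hIle δ s hs) _)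
  · refine hlim t (hs.trans hst) _ fun δ hδ => ?_
    have := lintegral_Ioi_le_inv (fun s hs => (hF δ hδ s hs).1)
      (fun s hs => (hF δ hδ s hs).2.1) (fun s hs => (hF δ hδ s hs).2.2) (by positivity)
      (by positivity) hs hst
    rwa [← hIeq δ hδ t (hs.trans hst)] at this

end Strip

/-! ### Logarithmic polar coordinates -/

section Rad

/-- The Euclidean norm on `ℝ × ℝ`, whose own norm is the maximum norm. -/
noncomputable def rad (z : ℝ × ℝ) : ℝ := ‖(⟨z.1, z.2⟩ : ℂ)‖

theorem rad_nonneg (z : ℝ × ℝ) : 0 ≤ rad z := norm_nonneg _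

theorem rad_sq (z : ℝ × ℝ) : rad z ^ 2 = z.1 ^ 2 + z.2 ^ 2 := by
  rw [rad, ← Complex.normSq_eq_norm_sq, Complex.normSq_mk]; ring

theorem rad_eq_sqrt (z : ℝ × ℝ) : rad z = √(z.1 ^ 2 + z.2 ^ 2) := by
  rw [← rad_sq, Real.sqrt_sq (rad_nonneg z)]

theorem continuous_rad : Continuous rad := by
  rw [show rad = fun z : ℝ × ℝ => √(z.1 ^ 2 + z.2 ^ 2) from funext rad_eq_sqrt]; fun_prop

theorem rad_add_le (z w : ℝ × ℝ) : rad (z + w) ≤ rad z + rad w :=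
  norm_add_le (⟨z.1, z.2⟩ : ℂ) ⟨w.1, w.2⟩

theorem rad_neg (z : ℝ × ℝ) : rad (-z) = rad z := norm_neg (⟨z.1, z.2⟩ : ℂ)

theorem rad_sub_comm (z w : ℝ × ℝ) : rad (z - w) = rad (w - z) := by rw [← rad_neg, neg_sub]

theorem rad_sub_le (z w v : ℝ × ℝ) : rad (z - w) ≤ rad (z - v) + rad (v - w) := by
  simpa using rad_add_le (z - v) (v - w)

theorem rad_le_add (z w : ℝ × ℝ) : rad z ≤ rad w + rad (z - w) := by
  simpa using rad_add_le w (z - w)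

theorem abs_snd_le_rad (z : ℝ × ℝ) : |z.2| ≤ rad z := Complex.abs_im_le_norm ⟨z.1, z.2⟩

theorem rad_le (z : ℝ × ℝ) : rad z ≤ |z.1| + |z.2| := Complex.norm_le_abs_re_add_abs_im ⟨z.1, z.2⟩

theorem rad_real (x : ℝ) : rad (x, 0) = |x| := by rw [rad_eq_sqrt]; simp [Real.sqrt_sq_eq_abs]

theorem rad_vert (x : ℝ) : rad (0, x) = |x| := by rw [rad_eq_sqrt]; simp [Real.sqrt_sq_eq_abs]

end Rad

section LogPolar

/-- Logarithmic polar coordinates. For `σ = 1` this is `c + exp (s + i θ)`, for `σ = -1` it is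
`c - exp (-(s + i θ))`; both are conformal and orientation preserving. -/
noncomputable def logPolar (σ : ℝ) (c z : ℝ × ℝ) : ℝ × ℝ :=
  (c.1 + σ * (Real.exp (σ * z.1) * Real.cos z.2), c.2 + Real.exp (σ * z.1) * Real.sin z.2)

variable {σ : ℝ} {c z : ℝ × ℝ} {p q f : ℝ × ℝ → ℝ} {U V : Set (ℝ × ℝ)}

/-- The derivative of `logPolar`. -/
noncomputable def logPolarDeriv (σ : ℝ) (z : ℝ × ℝ) : ℝ × ℝ →L[ℝ] ℝ × ℝ :=
  (Matrix.toLin (.finTwoProd ℝ) (.finTwoProd ℝ)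
    !![Real.exp (σ * z.1) * Real.cos z.2, -(σ * (Real.exp (σ * z.1) * Real.sin z.2));
      σ * (Real.exp (σ * z.1) * Real.sin z.2), Real.exp (σ * z.1) * Real.cos z.2]).toContinuousLinearMap

theorem logPolarDeriv_apply (v : ℝ × ℝ) : logPolarDeriv σ z v =
    (Real.exp (σ * z.1) * Real.cos z.2 * v.1 - σ * (Real.exp (σ * z.1) * Real.sin z.2) * v.2,
      σ * (Real.exp (σ * z.1) * Real.sin z.2) * v.1 + Real.exp (σ * z.1) * Real.cos z.2 * v.2) := by
  unfold logPolarDeriv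
  rw [Matrix.toLin_finTwoProd_toContinuousLinearMap]
  ext <;> simp [sub_eq_add_neg]

theorem det_logPolarDeriv (hσ : σ * σ = 1) :
    (logPolarDeriv σ z).det = Real.exp (σ * z.1) ^ 2 := by
  unfold logPolarDeriv
  simp only [LinearMap.det_toContinuousLinearMap, LinearMap.det_toLin, Matrix.det_fin_two_of]
  have := Real.sin_sq_add_cos_sq z.2
  linear_combination (Real.exp (σ * z.1)) ^ 2 * Real.sin z.2 ^ 2 * hσ
    + (Real.exp (σ * z.1)) ^ 2 * this

theorem hasFDerivAt_logPolar (hσ : σ * σ = 1) :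
    HasFDerivAt (logPolar σ c) (logPolarDeriv σ z) z := by
  have h1 : HasFDerivAt (Prod.fst : ℝ × ℝ → ℝ) (ContinuousLinearMap.fst ℝ ℝ ℝ) z := hasFDerivAt_fst
  have h2 : HasFDerivAt (Prod.snd : ℝ × ℝ → ℝ) (ContinuousLinearMap.snd ℝ ℝ ℝ) z := hasFDerivAt_snd
  have he : HasFDerivAt (fun z : ℝ × ℝ => Real.exp (σ * z.1))
      ((Real.exp (σ * z.1) * σ) • ContinuousLinearMap.fst ℝ ℝ ℝ) z := by
    have := (((hasDerivAt_id z.1).const_mul σ).exp).comp_hasFDerivAt z h1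
    simpa using! this
  have hcos := (Real.hasDerivAt_cos z.2).comp_hasFDerivAt z h2
  have hsin := (Real.hasDerivAt_sin z.2).comp_hasFDerivAt z h2
  have h := ((((he.mul hcos).const_mul σ).const_add c.1)).prodMk ((he.mul hsin).const_add c.2)
  refine h.congr_fderiv ?_
  ext
  all_goals simp [logPolarDeriv_apply]
  · linear_combination Real.exp (σ * z.1) * Real.cos z.2 * hσ
  · ring

theorem contDiff_logPolar : ContDiff ℝ 1 (logPolar σ c) := by
  unfold logPolar; fun_prop

theorem continuous_logPolar : Continuous (logPolar σ c) := by
  unfold logPolar; fun_prop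

theorem fderiv_apply_pair (a b : ℝ) : fderiv ℝ f z (a, b) = a * dx f z + b * dy f z := by
  have : ((a, b) : ℝ × ℝ) = a • ((1 : ℝ), (0 : ℝ)) + b • ((0 : ℝ), (1 : ℝ)) := by simp
  rw [this, map_add, map_smul, map_smul]; rfl

theorem dx_logPolar (hσ : σ * σ = 1) (hU : IsOpen U) (hf : ContDiffOn ℝ 1 f U)
    (hz : logPolar σ c z ∈ U) : dx (fun z => f (logPolar σ c z)) z =
      Real.exp (σ * z.1) * (Real.cos z.2 * dx f (logPolar σ c z)
        + σ * Real.sin z.2 * dy f (logPolar σ c z)) := by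
  have := (hasFDerivAt_of_contDiffOn hU hf hz).comp z (hasFDerivAt_logPolar hσ)
  change fderiv ℝ (f ∘ logPolar σ c) z (1, 0) = _
  rw [this.fderiv, ContinuousLinearMap.comp_apply, logPolarDeriv_apply, fderiv_apply_pair]
  simp only; ring

theorem dy_logPolar (hσ : σ * σ = 1) (hU : IsOpen U) (hf : ContDiffOn ℝ 1 f U)
    (hz : logPolar σ c z ∈ U) : dy (fun z => f (logPolar σ c z)) z =
      Real.exp (σ * z.1) * (-(σ * Real.sin z.2) * dx f (logPolar σ c z)
        + Real.cos z.2 * dy f (logPolar σ c z)) := by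
  have := (hasFDerivAt_of_contDiffOn hU hf hz).comp z (hasFDerivAt_logPolar hσ)
  change fderiv ℝ (f ∘ logPolar σ c) z (0, 1) = _
  rw [this.fderiv, ContinuousLinearMap.comp_apply, logPolarDeriv_apply, fderiv_apply_pair]
  simp only; ring

theorem jac_logPolar (hσ : σ * σ = 1) (hU : IsOpen U) (hp : ContDiffOn ℝ 1 p U)
    (hq : ContDiffOn ℝ 1 q U) (hz : logPolar σ c z ∈ U) :
    jac (fun z => p (logPolar σ c z)) (fun z => q (logPolar σ c z)) z =
      Real.exp (σ * z.1) ^ 2 * jac p q (logPolar σ c z) := by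
  unfold jac
  rw [dx_logPolar hσ hU hp hz, dx_logPolar hσ hU hq hz, dy_logPolar hσ hU hp hz,
    dy_logPolar hσ hU hq hz]
  have h1 := Real.sin_sq_add_cos_sq z.2
  generalize dx p (logPolar σ c z) = a
  generalize dy p (logPolar σ c z) = b
  generalize dx q (logPolar σ c z) = a'
  generalize dy q (logPolar σ c z) = b'
  linear_combination Real.exp (σ * z.1) ^ 2 * (a * b' - b * a') * (Real.sin z.2 ^ 2 * hσ + h1)

theorem QC.comp_logPolar {K : ℝ} (h : QC K p q U) (hσ : σ * σ = 1) (hU : IsOpen U)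
    (hV : MapsTo (logPolar σ c) V U) :
    QC K (fun z => p (logPolar σ c z)) (fun z => q (logPolar σ c z)) V where
  contDiffOn_fst := h.contDiffOn_fst.comp contDiff_logPolar.contDiffOn hV
  contDiffOn_snd := h.contDiffOn_snd.comp contDiff_logPolar.contDiffOn hV
  distortion := by
    intro z hz
    have hp := h.contDiffOn_fst
    have hq := h.contDiffOn_snd
    have hz' := hV hz
    rw [jac_logPolar hσ hU hp hq hz', dx_logPolar hσ hU hp hz', dx_logPolar hσ hU hq hz',
      dy_logPolar hσ hU hp hz', dy_logPolar hσ hU hq hz']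
    have h0 := mul_le_mul_of_nonneg_left (h.distortion _ hz') (sq_nonneg (Real.exp (σ * z.1)))
    have h1 := Real.sin_sq_add_cos_sq z.2
    generalize jac p q (logPolar σ c z) = J at *
    generalize dx p (logPolar σ c z) = a at *
    generalize dy p (logPolar σ c z) = b at *
    generalize dx q (logPolar σ c z) = a' at *
    generalize dy q (logPolar σ c z) = b' at *
    refine le_of_eq_of_le ?_ (h0.trans_eq (by ring))
    linear_combination Real.exp (σ * z.1) ^ 2 * ((a ^ 2 + a' ^ 2 + b ^ 2 + b' ^ 2)
      * (Real.sin z.2 ^ 2 * hσ + h1))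

end LogPolar

/-! ### Energy on discs, half-discs and exterior domains -/

/-- The integral of the Jacobian of `(p, q)` over `S`, which for quasiconformal maps is comparable
to the Dirichlet integral. -/
noncomputable def energy (p q : ℝ × ℝ → ℝ) (S : Set (ℝ × ℝ)) : ENNReal :=
  ∫⁻ z in S, ENNReal.ofReal (jac p q z)

theorem energy_mono {p q : ℝ × ℝ → ℝ} {S T : Set (ℝ × ℝ)} (h : S ⊆ T) :
    energy p q S ≤ energy p q T := lintegral_mono_set h

section Geometry

variable {σ : ℝ} {c z : ℝ × ℝ} {p q : ℝ × ℝ → ℝ} {U V : Set (ℝ × ℝ)}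

theorem rad_logPolar_sub (hσ : σ * σ = 1) : rad (logPolar σ c z - c) = Real.exp (σ * z.1) := by
  rw [rad_eq_sqrt]
  have h1 := Real.sin_sq_add_cos_sq z.2
  have : (logPolar σ c z - c).1 ^ 2 + (logPolar σ c z - c).2 ^ 2 = Real.exp (σ * z.1) ^ 2 := by
    simp only [logPolar, Prod.fst_sub, Prod.snd_sub, add_sub_cancel_left]
    linear_combination Real.exp (σ * z.1) ^ 2 * (Real.cos z.2 ^ 2 * hσ + h1)
  rw [this, Real.sqrt_sq (Real.exp_pos _).le]

theorem injOn_logPolar (hσ : σ * σ = 1) :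
    InjOn (logPolar σ c) (univ ×ˢ Ioc (-Real.pi) Real.pi) := by
  rintro ⟨s, t⟩ ⟨-, ht⟩ ⟨s', t'⟩ ⟨-, ht'⟩ heq
  have hσ0 : σ ≠ 0 := left_ne_zero_of_mul_eq_one hσ
  simp only [logPolar, Prod.mk.injEq, add_right_inj, mul_eq_mul_left_iff, hσ0, or_false] at heq
  have key : Complex.exp (⟨σ * s, t⟩ : ℂ) = Complex.exp (⟨σ * s', t'⟩ : ℂ) := by
    apply Complex.ext
    · rw [Complex.exp_re, Complex.exp_re]; exact heq.1
    · rw [Complex.exp_im, Complex.exp_im]; exact heq.2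
  have := Complex.exp_inj_of_neg_pi_lt_of_le_pi ht.1 ht.2 ht'.1 ht'.2 key
  rw [Complex.mk.injEq] at this
  exact Prod.ext (mul_left_cancel₀ hσ0 this.1) this.2

theorem exists_logPolar_eq (hσ : σ * σ = 1) {v : ℝ × ℝ} (hv : v ≠ c) :
    ∃ t ∈ Ioc (-Real.pi) Real.pi, logPolar σ c (σ * Real.log (rad (v - c)), t) = v ∧
      (c.2 < v.2 → t ∈ Ioo 0 Real.pi) := by
  set w : ℂ := ⟨σ * (v.1 - c.1), v.2 - c.2⟩ with hw
  have hnorm : ‖w‖ = rad (v - c) := by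
    rw [rad_eq_sqrt, Complex.norm_def, Complex.normSq_mk]
    congr 1
    simp only [Prod.fst_sub, Prod.snd_sub]
    linear_combination (v.1 - c.1) ^ 2 * hσ
  have hpos : 0 < rad (v - c) := by
    refine lt_of_le_of_ne (rad_nonneg _) fun h0 => hv ?_
    have h1 := rad_sq (v - c)
    rw [← h0] at h1
    simp only [Prod.fst_sub, Prod.snd_sub] at h1
    have e1 : (v.1 - c.1) ^ 2 = 0 := by nlinarith [sq_nonneg (v.1 - c.1), sq_nonneg (v.2 - c.2)]
    have e2 : (v.2 - c.2) ^ 2 = 0 := by nlinarith [sq_nonneg (v.1 - c.1), sq_nonneg (v.2 - c.2)]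
    exact Prod.ext (by linarith [pow_eq_zero_iff two_ne_zero |>.1 e1])
      (by linarith [pow_eq_zero_iff two_ne_zero |>.1 e2])
  refine ⟨Complex.arg w, Complex.arg_mem_Ioc w, ?_, fun hlt => ?_⟩
  · have e1 := Complex.norm_mul_cos_arg w
    have e2 := Complex.norm_mul_sin_arg w
    have e3 : Real.exp (σ * (σ * Real.log (rad (v - c)))) = ‖w‖ := by
      rw [← mul_assoc, hσ, one_mul, Real.exp_log hpos, hnorm]
    apply Prod.ext
    · simp only [logPolar]
      rw [e3, e1, hw]; simp only
      linear_combination (v.1 - c.1) * hσ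
    · simp only [logPolar]
      rw [e3, e2, hw]; simp
  · have him : 0 < w.im := by rw [hw]; simp only; linarith
    refine ⟨?_, ?_⟩
    · refine lt_of_le_of_ne (Complex.arg_nonneg_iff.2 him.le) fun h0 => ?_
      have := (Complex.arg_eq_zero_iff.1 h0.symm).2
      linarith
    · refine lt_of_le_of_ne (Complex.arg_le_pi w) fun h0 => ?_
      have := (Complex.arg_eq_pi_iff.1 h0).2
      linarith

theorem energy_image_logPolar (h : ContDiffOn ℝ 1 p U) (h' : ContDiffOn ℝ 1 q U) (hU : IsOpen U)
    (hσ : σ * σ = 1) (hVm : MeasurableSet V) (hV : MapsTo (logPolar σ c) V U)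
    (hVs : V ⊆ univ ×ˢ Ioc (-Real.pi) Real.pi) :
    energy p q (logPolar σ c '' V) = ∫⁻ z in V,
      ENNReal.ofReal (jac (fun z => p (logPolar σ c z)) (fun z => q (logPolar σ c z)) z) := by
  unfold energy
  rw [lintegral_image_eq_lintegral_abs_det_fderiv_mul volume hVm
    (fun z _ => (hasFDerivAt_logPolar hσ).hasFDerivWithinAt) ((injOn_logPolar hσ).mono hVs)]
  refine setLIntegral_congr_fun hVm fun z hz => ?_
  rw [det_logPolarDeriv hσ, jac_logPolar hσ hU h h' (hV hz), abs_of_nonneg (sq_nonneg _),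
    ENNReal.ofReal_mul (sq_nonneg _)]

end Geometry

section Images

variable {σ : ℝ} {c : ℝ × ℝ} {s : ℝ}

theorem logPolar_image_exterior :
    logPolar 1 0 '' (Ioi s ×ˢ Ioo 0 Real.pi) = {z | 0 < z.2 ∧ Real.exp s < rad z} := by
  ext v
  constructor
  · rintro ⟨z, ⟨hz1, hz2⟩, rfl⟩
    refine ⟨?_, ?_⟩
    · have := Real.sin_pos_of_mem_Ioo hz2
      simp only [logPolar, Prod.snd_zero, zero_add]; positivity
    · have := rad_logPolar_sub (σ := 1) (c := 0) (z := z) (by norm_num)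
      rw [sub_zero, one_mul] at this
      rw [this]; exact Real.exp_lt_exp.2 hz1
  · rintro ⟨hv, hr⟩
    have hne : v ≠ 0 := fun h0 => by rw [h0] at hv; exact lt_irrefl _ hv
    obtain ⟨t, -, ht, ht2⟩ := exists_logPolar_eq (σ := 1) (by norm_num) hne
    refine ⟨_, ⟨?_, ht2 hv⟩, ht⟩
    simp only [sub_zero, one_mul]
    exact (Real.lt_log_iff_exp_lt ((Real.exp_pos s).trans hr)).2 hr

theorem rad_lt_exp_iff {r : ℝ} (hr : 0 < r) : s < -1 * Real.log r ↔ r < Real.exp (-s) := by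
  rw [← Real.log_lt_iff_lt_exp hr]; constructor <;> intro h <;> linarith

theorem rad_sub_pos {v : ℝ × ℝ} (hv : v ≠ c) : 0 < rad (v - c) := by
  refine lt_of_le_of_ne (rad_nonneg _) fun h0 => hv ?_
  have : (⟨(v - c).1, (v - c).2⟩ : ℂ) = 0 := norm_eq_zero.1 h0.symm
  rw [Complex.ext_iff] at this
  simp only [Prod.fst_sub, Complex.zero_re, Prod.snd_sub, Complex.zero_im] at this
  exact Prod.ext (by linarith [this.1]) (by linarith [this.2])

theorem logPolar_image_halfDisc (hc : c.2 = 0) :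
    logPolar (-1) c '' (Ioi s ×ˢ Ioo 0 Real.pi) = {z | 0 < z.2 ∧ rad (z - c) < Real.exp (-s)} := by
  ext v
  constructor
  · rintro ⟨z, ⟨hz1, hz2⟩, rfl⟩
    refine ⟨?_, ?_⟩
    · have := Real.sin_pos_of_mem_Ioo hz2
      simp only [logPolar, hc, zero_add]; positivity
    · rw [rad_logPolar_sub (by norm_num)]
      have : s < z.1 := hz1
      exact Real.exp_lt_exp.2 (by linarith)
  · rintro ⟨hv, hr⟩
    have hne : v ≠ c := fun h0 => by rw [h0, hc] at hv; exact lt_irrefl _ hv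
    obtain ⟨t, -, ht, ht2⟩ := exists_logPolar_eq (σ := -1) (by norm_num) hne
    exact ⟨_, ⟨mem_Ioi.2 ((rad_lt_exp_iff (rad_sub_pos hne)).2 hr), ht2 (by rw [hc]; exact hv)⟩, ht⟩

theorem logPolar_image_disc :
    logPolar (-1) c '' (Ioi s ×ˢ Ioc (-Real.pi) Real.pi) = {z | rad (z - c) < Real.exp (-s)} \ {c} := by
  ext v
  constructor
  · rintro ⟨z, ⟨hz1, hz2⟩, rfl⟩
    have hr := rad_logPolar_sub (σ := -1) (c := c) (z := z) (by norm_num)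
    refine ⟨?_, fun h0 => ?_⟩
    · change rad _ < _
      rw [hr]
      have : s < z.1 := hz1
      exact Real.exp_lt_exp.2 (by linarith)
    · rw [mem_singleton_iff.1 h0, sub_self] at hr
      have := Real.exp_pos (-1 * z.1)
      rw [← hr, rad_eq_sqrt] at this
      simp at this
  · rintro ⟨hr, hne⟩
    obtain ⟨t, ht1, ht, -⟩ := exists_logPolar_eq (σ := -1) (by norm_num) hne
    exact ⟨_, ⟨mem_Ioi.2 ((rad_lt_exp_iff (rad_sub_pos hne)).2 hr), ht1⟩, ht⟩

end Images

section EnergyDecay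

variable {K M : ℝ} {p q : ℝ × ℝ → ℝ} {U : Set (ℝ × ℝ)}

/-- Decay of the energy in the half-plane, towards a boundary point (`σ = -1`) or towards infinity
(`σ = 1`). -/
theorem QC.energy_image_halfPlane_le {σ a : ℝ} {c : ℝ × ℝ} (h : QC K p q U) (hU : IsOpen U)
    (hK : 1 ≤ K) (hM : 0 < M) (hσ : σ * σ = 1) (hc : c.2 = 0)
    (hV : MapsTo (logPolar σ c) (Ioi a ×ˢ Ioo 0 Real.pi) U) (hq : ∀ z ∈ U, |q z| ≤ M)
    (hb : ∀ s, a < s → ∀ x, |x - c.1| = Real.exp (σ * s) →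
      Tendsto q (𝓝[{z | 0 < z.2}] (x, 0)) (𝓝 0)) {s t : ℝ} (hs : a < s) :
    (s ≤ t → energy p q (logPolar σ c '' (Ioi t ×ˢ Ioo 0 Real.pi)) ≤
      ENNReal.ofReal (Real.exp (-(2 * (K - √(K ^ 2 - 1)) * (t - s)))) *
        energy p q (logPolar σ c '' (Ioi s ×ˢ Ioo 0 Real.pi))) ∧
    (s < t → energy p q (logPolar σ c '' (Ioi t ×ˢ Ioo 0 Real.pi)) ≤
      ENNReal.ofReal (1 / ((K - √(K ^ 2 - 1)) / (M ^ 2 * Real.pi) * (t - s)))) := by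
  have hπ := Real.pi_pos
  have hσ1 : |σ| = 1 := by
    have := abs_mul_abs_self σ
    rw [hσ] at this
    nlinarith [abs_nonneg σ]
  have hstrip := h.comp_logPolar hσ hU hV
  have hsin : MapsTo (logPolar σ c) (Ioi a ×ˢ Ioo 0 Real.pi) {z | 0 < z.2} := fun z hz => by
    have := Real.sin_pos_of_mem_Ioo hz.2
    change 0 < (logPolar σ c z).2
    simp only [logPolar, hc, zero_add]; positivity
  have near : ∀ s, a < s → ∀ θ, |Real.cos θ| = 1 → ∀ δ, 0 < δ → ∃ e, 0 < e ∧ ∀ z,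
      dist z (s, θ) < e → z ∈ Ioi a ×ˢ Ioo 0 Real.pi → |q (logPolar σ c z)| ≤ δ := by
    intro s hs θ hθ δ hδ
    have hsθ : Real.sin θ = 0 := by
      have := Real.sin_sq_add_cos_sq θ
      rw [← sq_abs (Real.cos θ), hθ] at this
      exact pow_eq_zero_iff two_ne_zero |>.1 (by linarith)
    have hval : logPolar σ c (s, θ) = (c.1 + σ * (Real.exp (σ * s) * Real.cos θ), 0) := by
      simp [logPolar, hsθ, hc]
    have h1 := hb s hs (c.1 + σ * (Real.exp (σ * s) * Real.cos θ)) (by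
      rw [add_sub_cancel_left, abs_mul, abs_mul, hσ1, hθ, Real.abs_exp]; ring)
    rw [← hval] at h1
    have h2 := h1.comp ((continuous_logPolar (σ := σ) (c := c)).continuousWithinAt
      (x := (s, θ)).tendsto_nhdsWithin hsin)
    have h3 := (Metric.tendsto_nhdsWithin_nhds.1 h2) δ hδ
    obtain ⟨e, he, h4⟩ := h3
    refine ⟨e, he, fun z hz hzm => ?_⟩
    have := h4 hzm hz
    rw [dist_zero_right, Real.norm_eq_abs] at this
    exact this.le
  have hms : ∀ x : ℝ, MeasurableSet (Ioi x ×ˢ Ioo 0 Real.pi) := fun x =>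
    measurableSet_Ioi.prod measurableSet_Ioo
  have heq : ∀ x, a < x → energy p q (logPolar σ c '' (Ioi x ×ˢ Ioo 0 Real.pi)) = _ := fun x hx =>
    energy_image_logPolar h.contDiffOn_fst h.contDiffOn_snd hU hσ (hms x)
      (hV.mono_left fun z hz => ⟨hx.trans hz.1, hz.2⟩)
      (fun z hz => ⟨mem_univ _, by linarith [hz.2.1], hz.2.2.le⟩)
  have key := hstrip.lintegral_jac_strip_le hK hM (fun z hz => hq _ (hV hz)) ?_ (t := t) hs
  · refine ⟨fun hst => ?_, fun hst => ?_⟩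
    · rw [heq t (hs.trans_le hst), heq s hs]; exact key.1 hst
    · rw [heq t (hs.trans hst)]; exact key.2 hst
  · intro s hs δ hδ
    obtain ⟨e₁, he₁, h1⟩ := near s hs 0 (by simp) δ hδ
    obtain ⟨e₂, he₂, h2⟩ := near s hs Real.pi (by simp) δ hδ
    have hm : 0 < min (min e₁ e₂) (s - a) := lt_min (lt_min he₁ he₂) (by linarith)
    have m1 := (min_le_left (min e₁ e₂) (s - a)).trans (min_le_left _ _)
    have m2 := (min_le_left (min e₁ e₂) (s - a)).trans (min_le_right _ _)
    have m3 := min_le_right (min e₁ e₂) (s - a)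
    refine ⟨min (min e₁ e₂) (s - a) / 2, by linarith, fun x hx t ht hte => ?_⟩
    have hxs : |x - s| < min (min e₁ e₂) (s - a) := by
      rw [abs_lt]; constructor <;> linarith [hx.1, hx.2]
    have hmem : (x, t) ∈ Ioi a ×ˢ Ioo 0 Real.pi := ⟨by
      change a < x; rw [abs_lt] at hxs; linarith [hx.1], ht⟩
    rcases hte with hte | hte
    · refine h1 _ ?_ hmem
      rw [Prod.dist_eq, max_lt_iff, Real.dist_eq, Real.dist_eq]
      simp only
      rw [sub_zero, abs_of_pos ht.1]
      exact ⟨by linarith, by linarith⟩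
    · refine h2 _ ?_ hmem
      rw [Prod.dist_eq, max_lt_iff, Real.dist_eq, Real.dist_eq]
      simp only
      rw [abs_of_neg (by linarith [ht.2] : t - Real.pi < 0)]
      exact ⟨by linarith, by linarith⟩

theorem exp_neg_mul_log_sub {α r ρ : ℝ} (hr : 0 < r) (hρ : 0 < ρ) :
    Real.exp (-(2 * α * (Real.log r - Real.log ρ))) = (ρ / r) ^ (2 * α) := by
  rw [Real.rpow_def_of_pos (by positivity), Real.log_div hρ.ne' hr.ne']; ring_nf

/-- Decay of the energy on concentric discs. -/
theorem QC.energy_disc_le {r r' ρ : ℝ} {c : ℝ × ℝ} (h : QC K p q U) (hU : IsOpen U)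
    (hK : 1 ≤ K) (hM : 0 < M) (hV : {z | rad (z - c) < r} ⊆ U) (hq : ∀ z ∈ U, |q z| ≤ M)
    (hρ : 0 < ρ) (hρr : ρ ≤ r') (hr : r' < r) :
    energy p q {z | rad (z - c) < ρ} ≤
      ENNReal.ofReal ((ρ / r') ^ (2 * (K - √(K ^ 2 - 1)))) * energy p q {z | rad (z - c) < r'} := by
  have hr' : 0 < r' := hρ.trans_le hρr
  have hr0 : 0 < r := hr'.trans hr
  have hmap : MapsTo (logPolar (-1) c) (Ioi (-Real.log r) ×ˢ univ) U := by
    intro z hz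
    refine hV ?_
    change rad _ < _
    rw [rad_logPolar_sub (by norm_num), ← Real.lt_log_iff_exp_lt hr0]
    have : -Real.log r < z.1 := hz.1
    linarith
  have hper : ∀ z, logPolar (-1) c (z + (0, 2 * Real.pi)) = logPolar (-1) c z := fun z => by
    simp [logPolar]
  have heq : ∀ x : ℝ, 0 < x → x < r → energy p q {z | rad (z - c) < x} =
      ∫⁻ z in Ioi (-Real.log x) ×ˢ Ioc (-Real.pi) Real.pi, ENNReal.ofReal
        (jac (fun z => p (logPolar (-1) c z)) (fun z => q (logPolar (-1) c z)) z) := by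
    intro x hx hxr
    rw [← energy_image_logPolar h.contDiffOn_fst h.contDiffOn_snd hU (by norm_num)
      (measurableSet_Ioi.prod measurableSet_Ioc)
      (hmap.mono_left fun z hz => ⟨(by
        have := Real.log_lt_log hx hxr
        have h2 : -Real.log x < z.1 := hz.1
        change -Real.log r < z.1
        linarith), mem_univ _⟩)
      (fun z hz => ⟨mem_univ _, hz.2⟩), logPolar_image_disc, neg_neg, Real.exp_log hx]
    unfold energy
    exact setLIntegral_congr (sdiff_null_ae_eq_self (measure_singleton c)).symm
  rw [heq ρ hρ (hρr.trans_lt hr), heq r' hr' hr]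
  have key := (h.comp_logPolar (by norm_num) hU hmap).lintegral_jac_cylinder_le hK hM
    (fun z hz => hq _ (hmap hz)) (fun z => by rw [hper]) (fun z => by rw [hper])
    (s := -Real.log r') (t := -Real.log ρ) (by linarith [Real.log_lt_log hr' hr])
    (by linarith [Real.log_le_log hρ hρr])
  rwa [show -Real.log ρ - -Real.log r' = Real.log r' - Real.log ρ by ring,
    exp_neg_mul_log_sub hr' hρ] at key

/-- Decay of the energy on concentric half-discs centered on the boundary. -/
theorem QC.energy_halfDisc_le {r r' ρ x : ℝ} (h : QC K p q U) (hU : IsOpen U)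
    (hK : 1 ≤ K) (hM : 0 < M) (hV : {z | 0 < z.2 ∧ rad (z - (x, 0)) < r} ⊆ U)
    (hq : ∀ z ∈ U, |q z| ≤ M)
    (hb : ∀ y, |y - x| < r → Tendsto q (𝓝[{z | 0 < z.2}] (y, 0)) (𝓝 0))
    (hρ : 0 < ρ) (hρr : ρ ≤ r') (hr : r' < r) :
    energy p q {z | 0 < z.2 ∧ rad (z - (x, 0)) < ρ} ≤
      ENNReal.ofReal ((ρ / r') ^ (2 * (K - √(K ^ 2 - 1)))) *
        energy p q {z | 0 < z.2 ∧ rad (z - (x, 0)) < r'} := by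
  have hr' : 0 < r' := hρ.trans_le hρr
  have hr0 : 0 < r := hr'.trans hr
  have himg := fun s : ℝ => logPolar_image_halfDisc (c := (x, 0)) (s := s) rfl
  have key := (h.energy_image_halfPlane_le (σ := -1) (a := -Real.log r) (c := (x, 0)) hU hK hM
    (by norm_num) rfl (mapsTo_iff_image_subset.2 (by
      rw [himg, neg_neg, Real.exp_log hr0]; exact hV)) hq (fun s hs y hy => hb y (by
        rw [hy, ← Real.lt_log_iff_exp_lt hr0]; linarith))
    (s := -Real.log r') (t := -Real.log ρ) (by linarith [Real.log_lt_log hr' hr])).1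
    (by linarith [Real.log_le_log hρ hρr])
  rw [himg, himg, neg_neg, neg_neg, Real.exp_log hρ, Real.exp_log hr',
    show -Real.log ρ - -Real.log r' = Real.log r' - Real.log ρ by ring,
    exp_neg_mul_log_sub hr' hρ] at key
  exact key

/-- Decay of the energy towards infinity, and its bound in terms of the supremum of `|q|`. -/
theorem QC.energy_exterior_le {R r ρ : ℝ} (h : QC K p q {z | 0 < z.2 ∧ R < rad z})
    (hK : 1 ≤ K) (hM : 0 < M) (hq : ∀ z, 0 < z.2 → R < rad z → |q z| ≤ M)
    (hb : ∀ y, R < |y| → Tendsto q (𝓝[{z | 0 < z.2}] (y, 0)) (𝓝 0))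
    (hR : 0 < R) (hr : R < r) :
    (r ≤ ρ → energy p q {z | 0 < z.2 ∧ ρ < rad z} ≤
      ENNReal.ofReal ((r / ρ) ^ (2 * (K - √(K ^ 2 - 1)))) *
        energy p q {z | 0 < z.2 ∧ r < rad z}) ∧
    (r < ρ → energy p q {z | 0 < z.2 ∧ ρ < rad z} ≤ ENNReal.ofReal
      (1 / ((K - √(K ^ 2 - 1)) / (M ^ 2 * Real.pi) * (Real.log ρ - Real.log r)))) := by
  have hr0 : 0 < r := hR.trans hr
  have hU : IsOpen {z : ℝ × ℝ | 0 < z.2 ∧ R < rad z} :=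
    (isOpen_lt continuous_const continuous_snd).inter (isOpen_lt continuous_const continuous_rad)
  have key := h.energy_image_halfPlane_le (σ := 1) (a := Real.log R) (c := 0) hU hK hM
    (by norm_num) rfl (mapsTo_iff_image_subset.2 (by
      rw [logPolar_image_exterior, Real.exp_log hR])) (fun z hz => hq z hz.1 hz.2)
    (fun s hs y hy => hb y (by
      rw [Prod.fst_zero, sub_zero, one_mul] at hy
      rwa [hy, ← Real.log_lt_iff_lt_exp hR]))
    (s := Real.log r) (t := Real.log ρ) (Real.log_lt_log hR hr)
  simp only [logPolar_image_exterior] at key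
  refine ⟨fun hρ => ?_, fun hρ => ?_⟩
  · have hρ0 : 0 < ρ := hr0.trans_le hρ
    have k := key.1 (Real.log_le_log hr0 hρ)
    rwa [Real.exp_log hr0, Real.exp_log hρ0, exp_neg_mul_log_sub hρ0 hr0] at k
  · have k := key.2 (Real.log_lt_log hr0 hρ)
    rwa [Real.exp_log (hr0.trans hρ)] at k

end EnergyDecay

/-! ### Morrey's lemma -/

section Morrey

variable {f : ℝ × ℝ → ℝ} {U S : Set (ℝ × ℝ)}

/-- Change of variables for the contraction towards `v` by the factor `t`. -/
theorem ofReal_sq_mul_lintegral_homothety (hS : MeasurableSet S) (v : ℝ × ℝ) {t : ℝ} (ht : 0 < t)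
    (g : ℝ × ℝ → ENNReal) :
    ENNReal.ofReal (t ^ 2) * ∫⁻ u in S, g (v + t • (u - v)) =
      ∫⁻ z in (fun u => v + t • (u - v)) '' S, g z := by
  have hd : ∀ u ∈ S, HasFDerivWithinAt (fun u => v + t • (u - v))
      (t • ContinuousLinearMap.id ℝ (ℝ × ℝ)) S u := fun u _ =>
    ((((hasFDerivAt_id u).sub_const v).const_smul t).const_add v).hasFDerivWithinAt
  have hinj : InjOn (fun u => v + t • (u - v)) S := by
    intro a _ b _ hab
    simpa [ht.ne'] using hab
  rw [lintegral_image_eq_lintegral_abs_det_fderiv_mul volume hS hd hinj]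
  have hdet : (t • ContinuousLinearMap.id ℝ (ℝ × ℝ)).det = t ^ 2 := by
    rw [ContinuousLinearMap.det, ContinuousLinearMap.toLinearMap_smul, LinearMap.det_smul]
    simp
  rw [hdet, abs_of_nonneg (sq_nonneg t), lintegral_const_mul' _ _ ENNReal.ofReal_ne_top]

/-- The increment of a `C¹` function along a segment of a convex set. -/
theorem enorm_sub_le_lintegral_segment (hU : IsOpen U) (hf : ContDiffOn ℝ 1 f U) (hS : Convex ℝ S)
    (hSU : S ⊆ U) {N : ℝ × ℝ → ENNReal} (hx : ∀ z ∈ S, ‖dx f z‖ₑ ≤ N z)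
    (hy : ∀ z ∈ S, ‖dy f z‖ₑ ≤ N z) {u v : ℝ × ℝ} {h : ℝ} (hu : u ∈ S) (hv : v ∈ S)
    (huv : dist u v ≤ h) :
    ‖f u - f v‖ₑ ≤ 2 * ENNReal.ofReal h * ∫⁻ t in Ioc (0 : ℝ) 1, N (v + t • (u - v)) := by
  have hm : ∀ t ∈ Icc (0 : ℝ) 1, v + t • (u - v) ∈ S := fun t ht =>
    hS.add_smul_sub_mem hv hu ht
  have hd : ∀ t ∈ uIcc (0 : ℝ) 1, HasDerivAt (fun t => f (v + t • (u - v)))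
      (fderiv ℝ f (v + t • (u - v)) (u - v)) t := by
    intro t ht
    rw [uIcc_of_le zero_le_one] at ht
    have h1 : HasDerivAt (fun t : ℝ => v + t • (u - v)) (u - v) t := by
      simpa using! (((hasDerivAt_id t).smul_const (u - v)).const_add v)
    exact (hasFDerivAt_of_contDiffOn hU hf (hSU (hm t ht))).comp_hasDerivAt t h1
  have hc : IntervalIntegrable (fun t => fderiv ℝ f (v + t • (u - v)) (u - v)) volume 0 1 := by
    apply ContinuousOn.intervalIntegrable
    rw [uIcc_of_le zero_le_one]
    refine ContinuousOn.clm_apply ?_ continuousOn_const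
    exact (hf.continuousOn_fderiv_of_isOpen hU le_rfl).comp (by fun_prop)
      fun t ht => hSU (hm t ht)
  have hI := intervalIntegral.integral_eq_sub_of_hasDerivAt hd hc
  simp only [one_smul, zero_smul, add_zero, add_sub_cancel] at hI
  rw [← hI, intervalIntegral.integral_of_le zero_le_one]
  refine (enorm_integral_le_lintegral_enorm _).trans ?_
  rw [← lintegral_const_mul' _ _ (by finiteness)]
  refine setLIntegral_mono' measurableSet_Ioc fun t ht => ?_
  have hz := hm t (Ioc_subset_Icc_self ht)
  rw [show u - v = ((u - v).1, (u - v).2) from rfl, fderiv_apply_pair]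
  rw [Prod.dist_eq, max_le_iff, Real.dist_eq, Real.dist_eq] at huv
  have b1 : ‖(u - v).1‖ₑ ≤ ENNReal.ofReal h := by
    rw [Real.enorm_eq_ofReal_abs]; exact ENNReal.ofReal_le_ofReal huv.1
  have b2 : ‖(u - v).2‖ₑ ≤ ENNReal.ofReal h := by
    rw [Real.enorm_eq_ofReal_abs]; exact ENNReal.ofReal_le_ofReal huv.2
  refine (enorm_add_le _ _).trans ?_
  rw [enorm_mul, enorm_mul]
  calc _ ≤ ENNReal.ofReal h * N (v + t • (u - v)) + ENNReal.ofReal h * N (v + t • (u - v)) :=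
        add_le_add (mul_le_mul' b1 (hx _ hz)) (mul_le_mul' b2 (hy _ hz))
    _ = _ := by ring

/-- The Cauchy-Schwarz inequality for the integral of a function over a set of area at most
`V ^ 2`. -/
theorem lintegral_le_of_sq {N : ℝ × ℝ → ENNReal} (hN : Measurable N) {B V : ℝ} (hB : 0 ≤ B)
    (hV : 0 ≤ V) (hSV : volume S ≤ ENNReal.ofReal (V ^ 2))
    (h : ∫⁻ z in S, N z ^ 2 ≤ ENNReal.ofReal (B ^ 2)) :
    ∫⁻ z in S, N z ≤ ENNReal.ofReal (B * V) := by
  have key := ENNReal.lintegral_mul_le_Lp_mul_Lq (volume.restrict S) Real.HolderConjugate.two_two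
    (f := N) (g := fun _ => 1) hN.aemeasurable aemeasurable_const
  have sqrt_sq : ∀ {x : ℝ}, 0 ≤ x → ENNReal.ofReal (x ^ 2) ^ (1 / 2 : ℝ) = ENNReal.ofReal x := by
    intro x hx
    rw [ENNReal.ofReal_rpow_of_nonneg (sq_nonneg x) (by norm_num), ← Real.sqrt_eq_rpow,
      Real.sqrt_sq hx]
  simp only [Pi.mul_apply, mul_one, ENNReal.rpow_ofNat, one_pow, lintegral_const, one_mul,
    Measure.restrict_apply MeasurableSet.univ, univ_inter] at key
  refine key.trans ?_
  rw [ENNReal.ofReal_mul hB, ← sqrt_sq hB, ← sqrt_sq hV]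
  gcongr

/-- Morrey's lemma on a square, in the form of a chain through a well chosen third point: if the
square integral of the gradient over the square shrunk by the factor `t` towards `x` or `y` is at
most `(B t ^ α) ^ 2`, then `|f x - f y| ≤ 4 B / α`. -/
theorem abs_sub_le_of_morrey (hU : IsOpen U) (hf : ContDiffOn ℝ 1 f U) {a : ℝ × ℝ} {h : ℝ}
    (hh : 0 < h) (hSU : Icc a (a + (h, h)) ⊆ U) {N : ℝ × ℝ → ENNReal} (hN : Measurable N)
    (hNx : ∀ z ∈ Icc a (a + (h, h)), ‖dx f z‖ₑ ≤ N z)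
    (hNy : ∀ z ∈ Icc a (a + (h, h)), ‖dy f z‖ₑ ≤ N z) {x y : ℝ × ℝ}
    (hx : x ∈ Icc a (a + (h, h))) (hy : y ∈ Icc a (a + (h, h))) {α B : ℝ} (hα : 0 < α)
    (hB : 0 ≤ B)
    (hE : ∀ v, v = x ∨ v = y → ∀ t ∈ Ioc (0 : ℝ) 1,
      ∫⁻ z in (fun u => v + t • (u - v)) '' Icc a (a + (h, h)), N z ^ 2 ≤
        ENNReal.ofReal ((B * t ^ α) ^ 2)) :
    |f x - f y| ≤ 4 * B / α := by
  set S := Icc a (a + (h, h)) with hSdef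
  have hSm : MeasurableSet S := measurableSet_Icc
  have hSv : volume S = ENNReal.ofReal (h ^ 2) := by
    rw [hSdef, Measure.volume_eq_prod,
      show Icc a (a + (h, h)) = Icc a.1 (a.1 + h) ×ˢ Icc a.2 (a.2 + h) from (Icc_prod_eq _ _),
      Measure.prod_prod, Real.volume_Icc, Real.volume_Icc, add_sub_cancel_left,
      add_sub_cancel_left, ← ENNReal.ofReal_mul hh.le, pow_two]
  have hdist : ∀ u ∈ S, ∀ v ∈ S, dist u v ≤ h := by
    intro u hu v hv
    have e1 := hu.1.1
    have e2 := hu.1.2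
    have e3 := hu.2.1
    have e4 := hu.2.2
    have f1 := hv.1.1
    have f2 := hv.1.2
    have f3 := hv.2.1
    have f4 := hv.2.2
    simp only [Prod.fst_add, Prod.snd_add] at e3 e4 f3 f4
    rw [Prod.dist_eq, max_le_iff, Real.dist_eq, Real.dist_eq, abs_le, abs_le]
    exact ⟨⟨by linarith, by linarith⟩, ⟨by linarith, by linarith⟩⟩
  -- the integral of the gradient along the segment from `v` to `u`
  set T : ℝ × ℝ → ℝ × ℝ → ENNReal := fun v u => ∫⁻ t in Ioc (0 : ℝ) 1, N (v + t • (u - v)) with hT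
  have hjoint : ∀ v, Measurable (fun w : (ℝ × ℝ) × ℝ => N (v + w.2 • (w.1 - v))) := fun v =>
    hN.comp (by fun_prop)
  have hTm : ∀ v, Measurable (T v) := fun v => (hjoint v).lintegral_prod_right'
  have hTI : ∀ v, v = x ∨ v = y → ∫⁻ u in S, T v u ≤ ENNReal.ofReal (B * h / α) := by
    intro v hv
    rw [hT, lintegral_lintegral_swap (hjoint v).aemeasurable]
    have hin : ∀ t ∈ Ioc (0 : ℝ) 1, ∫⁻ u in S, N (v + t • (u - v)) ≤
        ENNReal.ofReal (B * t ^ (α - 1) * h) := by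
      intro t ht
      refine lintegral_le_of_sq (hN.comp (by fun_prop))
        (mul_nonneg hB (Real.rpow_nonneg ht.1.le _)) hh.le hSv.le ?_
      have h1 := ofReal_sq_mul_lintegral_homothety hSm v ht.1 (fun z => N z ^ 2)
      have h2 := hE v hv t ht
      rw [← h1] at h2
      have h3 : (B * t ^ α) ^ 2 = t ^ 2 * (B * t ^ (α - 1)) ^ 2 := by
        have ht0 : t ≠ 0 := ht.1.ne'
        rw [Real.rpow_sub_one ht0]; field_simp
      rw [h3, ENNReal.ofReal_mul (sq_nonneg t)] at h2
      exact (ENNReal.mul_le_mul_iff_right (by simpa using ht.1.ne') ENNReal.ofReal_ne_top).1 h2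
    refine (setLIntegral_mono' measurableSet_Ioc hin).trans ?_
    have hint : IntervalIntegrable (fun t : ℝ => B * t ^ (α - 1) * h) volume 0 1 :=
      ((intervalIntegral.intervalIntegrable_rpow' (by linarith)).const_mul B).mul_const h
    rw [← ofReal_integral_eq_lintegral_ofReal hint.1
      (by
        filter_upwards [ae_restrict_mem measurableSet_Ioc] with t ht
        exact mul_nonneg (mul_nonneg hB (Real.rpow_nonneg ht.1.le _)) hh.le),
      ← intervalIntegral.integral_of_le zero_le_one]
    rw [intervalIntegral.integral_mul_const, intervalIntegral.integral_const_mul,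
      integral_rpow (Or.inl (by linarith))]
    apply le_of_eq
    rw [sub_add_cancel, Real.one_rpow, Real.zero_rpow hα.ne']
    congr 1; ring
  have hsum : ∫⁻ u in S, (T x u + T y u) ≤ ENNReal.ofReal (2 * (B * h / α)) := by
    rw [lintegral_add_left (hTm x), two_mul, ENNReal.ofReal_add (by positivity) (by positivity)]
    exact add_le_add (hTI x (Or.inl rfl)) (hTI y (Or.inr rfl))
  obtain ⟨u, hu, hle⟩ := exists_le_setLAverage (μ := volume) (s := S)
    (f := fun u => T x u + T y u) (by rw [hSv]; simpa using hh.ne')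
    (by rw [hSv]; exact ENNReal.ofReal_ne_top) ((hTm x).add (hTm y)).aemeasurable
  have hle2 : T x u + T y u ≤ ENNReal.ofReal (2 * B / (α * h)) := by
    refine hle.trans ?_
    rw [setLAverage_eq, hSv]
    refine (ENNReal.div_le_div_right hsum _).trans ?_
    rw [← ENNReal.ofReal_div_of_pos (by positivity)]
    apply le_of_eq; congr 1; field_simp
  have k1 := enorm_sub_le_lintegral_segment hU hf (convex_Icc _ _) hSU hNx hNy hu hx (hdist u hu x hx)
  have k2 := enorm_sub_le_lintegral_segment hU hf (convex_Icc _ _) hSU hNx hNy hu hy (hdist u hu y hy)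
  have k3 : ‖f x - f y‖ₑ ≤ ENNReal.ofReal (4 * B / α) := by
    calc ‖f x - f y‖ₑ = ‖(f u - f y) - (f u - f x)‖ₑ := by congr 1; ring
      _ ≤ ‖f u - f y‖ₑ + ‖f u - f x‖ₑ := enorm_sub_le
      _ ≤ 2 * ENNReal.ofReal h * T y u + 2 * ENNReal.ofReal h * T x u := add_le_add k2 k1
      _ = 2 * ENNReal.ofReal h * (T x u + T y u) := by ring
      _ ≤ 2 * ENNReal.ofReal h * ENNReal.ofReal (2 * B / (α * h)) := by gcongr
      _ = ENNReal.ofReal (4 * B / α) := by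
        rw [show (2 : ENNReal) = ENNReal.ofReal 2 by simp, ← ENNReal.ofReal_mul (by norm_num),
          ← ENNReal.ofReal_mul (by positivity)]
        congr 1; field_simp; ring
  rw [Real.enorm_eq_ofReal_abs] at k3
  exact (ENNReal.ofReal_le_ofReal_iff (by positivity)).1 k3

end Morrey

/-! ### Local estimates -/

section Local

variable {K M R : ℝ} {p q : ℝ × ℝ → ℝ}

theorem isOpen_exterior : IsOpen {z : ℝ × ℝ | 0 < z.2 ∧ R < rad z} :=
  (isOpen_lt continuous_const continuous_snd).inter (isOpen_lt continuous_const continuous_rad)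

/-- Growth of the energy on discs around an arbitrary point of the half-plane: below the distance
to the boundary the disc estimate applies, above it the estimate on half-discs around the
projection of the point to the boundary. -/
theorem QC.energy_near_le (h : QC K p q {z | 0 < z.2 ∧ R < rad z})
    (hK : 1 ≤ K) (hM : 0 < M) (hq : ∀ z, 0 < z.2 → R < rad z → |q z| ≤ M)
    (hb : ∀ y, R < |y| → Tendsto q (𝓝[{z | 0 < z.2}] (y, 0)) (𝓝 0))
    {z : ℝ × ℝ} {r ρ : ℝ} (hz : 0 < z.2) (hr : 0 < r) (hRr : R + 4 * r ≤ rad z)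
    (hρ : 0 < ρ) (hρr : ρ ≤ r / 2) :
    energy p q {w | 0 < w.2 ∧ rad (w - z) < ρ} ≤
      ENNReal.ofReal ((2 * ρ / r) ^ (2 * (K - √(K ^ 2 - 1)))) *
        energy p q {w | 0 < w.2 ∧ rad z - 3 * r < rad w} := by
  have hα := expo_pos hK
  have hU : IsOpen {z : ℝ × ℝ | 0 < z.2 ∧ R < rad z} := isOpen_exterior
  have hq' : ∀ z ∈ {z : ℝ × ℝ | 0 < z.2 ∧ R < rad z}, |q z| ≤ M := fun z hz => hq z hz.1 hz.2
  have lower : ∀ w : ℝ × ℝ, rad z ≤ rad w + rad (w - z) := fun w => by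
    rw [rad_sub_comm]; exact rad_le_add z w
  have upper : ∀ w : ℝ × ℝ, z.2 - rad (w - z) ≤ w.2 := fun w => by
    have := (abs_le.1 (abs_snd_le_rad (w - z))).1
    simp only [Prod.snd_sub] at this; linarith
  rcases le_or_gt r z.2 with hd | hd
  · have key := h.energy_disc_le (c := z) (r := r) (r' := r / 2) (ρ := ρ) hU hK hM (fun w hw => ?_)
      hq' hρ hρr (by linarith)
    · rw [show ρ / (r / 2) = 2 * ρ / r by field_simp] at key
      refine (energy_mono fun w hw => hw.2).trans (key.trans ?_)
      gcongr
      refine energy_mono fun w hw => ?_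
      have hw' : rad (w - z) < r / 2 := hw
      exact ⟨by linarith [upper w], by linarith [lower w]⟩
    · have hw' : rad (w - z) < r := hw
      exact ⟨by linarith [upper w], by linarith [lower w]⟩
  · have hzc : ∀ w : ℝ × ℝ, rad z ≤ rad w + rad (w - (z.1, 0)) + z.2 := fun w => by
      have e1 := rad_sub_le z w (z.1, 0)
      have e2 : rad (z - (z.1, 0)) = z.2 := by
        rw [show z - (z.1, 0) = (0, z.2) by ext <;> simp, rad_vert, abs_of_pos hz]
      have e3 := rad_le_add z w
      rw [e2, rad_sub_comm (z.1, 0)] at e1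
      linarith
    have hcz : ∀ w : ℝ × ℝ, rad (w - (z.1, 0)) ≤ rad (w - z) + z.2 := fun w => by
      have e1 := rad_sub_le w (z.1, 0) z
      have e2 : rad (z - (z.1, 0)) = z.2 := by
        rw [show z - (z.1, 0) = (0, z.2) by ext <;> simp, rad_vert, abs_of_pos hz]
      linarith
    have half : ∀ s, 0 < s → s ≤ 2 * r → energy p q {w | 0 < w.2 ∧ rad (w - (z.1, 0)) < s} ≤
        ENNReal.ofReal ((s / (2 * r)) ^ (2 * (K - √(K ^ 2 - 1)))) *
          energy p q {w | 0 < w.2 ∧ rad z - 3 * r < rad w} := by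
      intro s hs hsr
      have key := h.energy_halfDisc_le (r := 3 * r) (r' := 2 * r) (x := z.1) hU hK hM
        (fun w hw => ⟨hw.1, by linarith [hzc w, hw.2]⟩) hq' (fun y hy => hb y ?_) hs hsr
        (by linarith)
      · refine key.trans ?_
        gcongr
        refine energy_mono fun w hw => ⟨hw.1, ?_⟩
        linarith [hzc w, hw.2]
      · have e1 := hzc (y, 0)
        rw [show ((y, 0) : ℝ × ℝ) - (z.1, 0) = (y - z.1, 0) by simp, rad_real, rad_real] at e1
        linarith
    rcases le_or_gt ρ (z.2 / 2) with hρd | hρd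
    · have key := h.energy_disc_le (c := z) (r := z.2) (r' := z.2 / 2) (ρ := ρ) hU hK hM
        (fun w hw => ?_) hq' hρ hρd (by linarith)
      · refine (energy_mono fun w hw => hw.2).trans (key.trans ?_)
        have h2 := half (2 * z.2) (by linarith) (by linarith)
        have h3 : energy p q {w | rad (w - z) < z.2 / 2} ≤
            energy p q {w | 0 < w.2 ∧ rad (w - (z.1, 0)) < 2 * z.2} := by
          refine energy_mono fun w hw => ?_
          have hw' : rad (w - z) < z.2 / 2 := hw
          exact ⟨by linarith [upper w], by linarith [hcz w]⟩
        refine (mul_le_mul_right (h3.trans h2) _).trans (le_of_eq ?_)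
        rw [← mul_assoc, ← ENNReal.ofReal_mul (by positivity),
          ← Real.mul_rpow (by positivity) (by positivity),
          show ρ / (z.2 / 2) * (2 * z.2 / (2 * r)) = 2 * ρ / r by field_simp]
      · have hw' : rad (w - z) < z.2 := hw
        exact ⟨by linarith [upper w], by linarith [lower w]⟩
    · have h2 := half (3 * ρ) (by linarith) (by linarith)
      have h3 : {w : ℝ × ℝ | 0 < w.2 ∧ rad (w - z) < ρ} ⊆
          {w | 0 < w.2 ∧ rad (w - (z.1, 0)) < 3 * ρ} := fun w hw =>
        ⟨hw.1, by linarith [hcz w, hw.2]⟩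
      refine (energy_mono h3).trans (h2.trans ?_)
      · gcongr ENNReal.ofReal (?_ ^ _) * _
        rw [div_le_div_iff₀ (by positivity) hr]
        nlinarith

theorem QC.enorm_deriv_le {U : Set (ℝ × ℝ)} (h : QC K p q U) {z : ℝ × ℝ} (hz : z ∈ U) :
    (‖dx p z‖ₑ ≤ ENNReal.ofReal √(2 * K * jac p q z) ∧
      ‖dy p z‖ₑ ≤ ENNReal.ofReal √(2 * K * jac p q z)) ∧
    (‖dx q z‖ₑ ≤ ENNReal.ofReal √(2 * K * jac p q z) ∧
      ‖dy q z‖ₑ ≤ ENNReal.ofReal √(2 * K * jac p q z)) := by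
  have hd := h.distortion z hz
  have key : ∀ x : ℝ, x ^ 2 ≤ 2 * K * jac p q z →
      ‖x‖ₑ ≤ ENNReal.ofReal √(2 * K * jac p q z) := fun x hx => by
    rw [Real.enorm_eq_ofReal_abs]
    exact ENNReal.ofReal_le_ofReal (Real.abs_le_sqrt hx)
  refine ⟨⟨key _ ?_, key _ ?_⟩, key _ ?_, key _ ?_⟩ <;>
    nlinarith [sq_nonneg (dx p z), sq_nonneg (dy p z), sq_nonneg (dx q z), sq_nonneg (dy q z)]

/-- Hölder continuity at a pair of points from the growth of the energy on discs around them. -/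
theorem QC.abs_sub_le_of_energy (h : QC K p q {z | 0 < z.2 ∧ R < rad z}) (hK : 1 ≤ K) {x y : ℝ × ℝ}
    {α A : ℝ} (hα : 0 < α) (hA : 0 ≤ A) (hx : 0 < x.2) (hy : 0 < y.2)
    (hRx : R + 3 * dist x y ≤ rad x)
    (hE : ∀ v, v = x ∨ v = y → ∀ ρ, 0 < ρ → ρ ≤ 3 * dist x y →
      energy p q {w | 0 < w.2 ∧ rad (w - v) < ρ} ≤ ENNReal.ofReal ((A * ρ ^ α) ^ 2)) :
    |p x - p y| ≤ 4 * (√(2 * K) * (A * (3 * dist x y) ^ α)) / α ∧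
    |q x - q y| ≤ 4 * (√(2 * K) * (A * (3 * dist x y) ^ α)) / α := by
  rcases eq_or_ne x y with rfl | hne
  · simp only [sub_self, abs_zero]
    constructor <;> positivity
  set d := dist x y with hd
  have hd0 : 0 < d := dist_pos.2 hne
  have hd1 : |x.1 - y.1| ≤ d := by rw [← Real.dist_eq]; exact le_max_left _ _
  have hd2 : |x.2 - y.2| ≤ d := by rw [← Real.dist_eq]; exact le_max_right _ _
  -- a square of side `d` in the half-plane that contains `x` and `y`
  set a : ℝ × ℝ := (min x.1 y.1, min x.2 y.2) with ha
  have hm1 : max x.1 y.1 - min x.1 y.1 ≤ d := by rw [max_sub_min_eq_abs']; exact hd1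
  have hm2 : max x.2 y.2 - min x.2 y.2 ≤ d := by rw [max_sub_min_eq_abs']; exact hd2
  have hxS : x ∈ Icc a (a + (d, d)) := by
    refine ⟨⟨min_le_left _ _, min_le_left _ _⟩, ?_, ?_⟩
    · have := le_max_left x.1 y.1; simp only [ha, Prod.fst_add]; linarith
    · have := le_max_left x.2 y.2; simp only [ha, Prod.snd_add]; linarith
  have hyS : y ∈ Icc a (a + (d, d)) := by
    refine ⟨⟨min_le_right _ _, min_le_right _ _⟩, ?_, ?_⟩
    · have := le_max_right x.1 y.1; simp only [ha, Prod.fst_add]; linarith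
    · have := le_max_right x.2 y.2; simp only [ha, Prod.snd_add]; linarith
  have hpos : ∀ z ∈ Icc a (a + (d, d)), 0 < z.2 := fun z hz =>
    (lt_min hx hy).trans_le hz.1.2
  have hrad : ∀ z ∈ Icc a (a + (d, d)), ∀ w ∈ Icc a (a + (d, d)), rad (z - w) ≤ 2 * d := by
    intro z hz w hw
    refine (rad_le _).trans ?_
    have e1 := hz.1.1
    have e2 := hz.1.2
    have e3 := hz.2.1
    have e4 := hz.2.2
    have f1 := hw.1.1
    have f2 := hw.1.2
    have f3 := hw.2.1
    have f4 := hw.2.2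
    simp only [Prod.fst_add, Prod.snd_add] at e3 e4 f3 f4
    have g1 : |(z - w).1| ≤ d := by
      simp only [Prod.fst_sub]; rw [abs_le]; constructor <;> linarith
    have g2 : |(z - w).2| ≤ d := by
      simp only [Prod.snd_sub]; rw [abs_le]; constructor <;> linarith
    linarith
  have hSU : Icc a (a + (d, d)) ⊆ {z : ℝ × ℝ | 0 < z.2 ∧ R < rad z} := by
    intro z hz
    refine ⟨hpos z hz, ?_⟩
    have e1 := rad_le_add x z
    have e2 := hrad x hxS z hz
    linarith
  set N : ℝ × ℝ → ENNReal := fun z => ENNReal.ofReal √(2 * K * jac p q z) with hN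
  have hNm : Measurable N := (measurable_jac.const_mul (2 * K)).sqrt.ennreal_ofReal
  have hNE : ∀ v, v = x ∨ v = y → ∀ t ∈ Ioc (0 : ℝ) 1,
      ∫⁻ z in (fun u => v + t • (u - v)) '' Icc a (a + (d, d)), N z ^ 2 ≤
        ENNReal.ofReal ((√(2 * K) * (A * (3 * d) ^ α) * t ^ α) ^ 2) := by
    intro v hv t ht
    have hvS : v ∈ Icc a (a + (d, d)) := by rcases hv with rfl | rfl <;> assumption
    have hsub : (fun u => v + t • (u - v)) '' Icc a (a + (d, d)) ⊆
        {w | 0 < w.2 ∧ rad (w - v) < 3 * d * t} := by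
      rintro _ ⟨u, hu, rfl⟩
      refine ⟨hpos _ ((convex_Icc _ _).add_smul_sub_mem hvS hu ⟨ht.1.le, ht.2⟩), ?_⟩
      have e1 : rad (t • (u - v)) = t * rad (u - v) := by
        rw [rad_eq_sqrt, rad_eq_sqrt]
        simp only [Prod.smul_fst, Prod.smul_snd, smul_eq_mul]
        rw [show (t * (u - v).1) ^ 2 + (t * (u - v).2) ^ 2 =
          t ^ 2 * ((u - v).1 ^ 2 + (u - v).2 ^ 2) by ring, Real.sqrt_mul (sq_nonneg t),
          Real.sqrt_sq ht.1.le]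
      rw [add_sub_cancel_left, e1]
      have e2 := hrad u hu v hvS
      nlinarith [ht.1]
    have hsq : ∀ z, N z ^ 2 = ENNReal.ofReal (2 * K) * ENNReal.ofReal (jac p q z) := fun z => by
      simp only [hN]
      rw [← ENNReal.ofReal_mul (by linarith), ← ENNReal.ofReal_pow (Real.sqrt_nonneg _)]
      rcases le_total 0 (2 * K * jac p q z) with h0 | h0
      · rw [Real.sq_sqrt h0]
      · rw [Real.sqrt_eq_zero_of_nonpos h0, ENNReal.ofReal_of_nonpos h0]; simp
    refine (lintegral_mono_set hsub).trans ?_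
    simp only [hsq]
    rw [lintegral_const_mul' _ _ ENNReal.ofReal_ne_top]
    refine (mul_le_mul_right (hE v hv (3 * d * t) (by have := ht.1; positivity)
      (by nlinarith [ht.2])) _).trans ?_
    rw [← ENNReal.ofReal_mul (by linarith)]
    apply le_of_eq
    congr 1
    rw [Real.mul_rpow (by positivity) ht.1.le]
    have := Real.sq_sqrt (show 0 ≤ 2 * K by linarith)
    linear_combination -(A * (3 * d) ^ α * t ^ α) ^ 2 * this
  have hB : 0 ≤ √(2 * K) * (A * (3 * d) ^ α) := by positivity
  exact ⟨abs_sub_le_of_morrey isOpen_exterior h.contDiffOn_fst hd0 hSU hNm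
      (fun z hz => (h.enorm_deriv_le (hSU hz)).1.1) (fun z hz => (h.enorm_deriv_le (hSU hz)).1.2)
      hxS hyS hα hB hNE,
    abs_sub_le_of_morrey isOpen_exterior h.contDiffOn_snd hd0 hSU hNm
      (fun z hz => (h.enorm_deriv_le (hSU hz)).2.1) (fun z hz => (h.enorm_deriv_le (hSU hz)).2.2)
      hxS hyS hα hB hNE⟩

end Local

/-! ### Uniform estimates and the oscillation at infinity -/

section Uniform

/-- The data of the problem in the coordinate plane: a quasiconformal map outside a
half-disc whose second component is bounded and tends to zero at the flat part of the boundary. -/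
structure ExteriorMap (K R M : ℝ) (p q : ℝ × ℝ → ℝ) : Prop where
  qc : QC K p q {z | 0 < z.2 ∧ R < rad z}
  abs_snd_le : ∀ z, 0 < z.2 → R < rad z → |q z| ≤ M
  tendsto_snd : ∀ y, R < |y| → Tendsto q (𝓝[{z | 0 < z.2}] (y, 0)) (𝓝 0)

/-- Hölder continuity at scale `r` far from the origin. The factor `r ^ (-2α)` combines the scaling
of the Hölder estimate with the decay of the energy at infinity. -/
def HolderFar (C α κ R' : ℝ) (g : ℝ × ℝ → ℝ) : Prop :=
  ∀ r, R' ≤ r → ∀ x y : ℝ × ℝ, 0 < x.2 → 0 < y.2 → r ≤ rad x → r ≤ rad y →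
    24 * dist x y ≤ κ * r → |g x - g y| ≤ C * (dist x y ^ α * r ^ (-(2 * α)))

/-- The constant is uniform over all exterior maps with the given parameters. -/
theorem exists_holderFar {K R R' M : ℝ} (hK : 1 ≤ K) (hR : 0 < R) (hR' : R < R') (hM : 0 < M) :
    ∃ C, 0 < C ∧ ∀ p q, ExteriorMap K R M p q →
      HolderFar C (K - √(K ^ 2 - 1)) (1 - R / R') R' p ∧
      HolderFar C (K - √(K ^ 2 - 1)) (1 - R / R') R' q := by
  have hα := expo_pos hK
  have hR'0 : 0 < R' := hR.trans hR'
  set α := K - √(K ^ 2 - 1) with hαdef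
  set κ := 1 - R / R' with hκ
  have hκ0 : 0 < κ := by rw [hκ, sub_pos, div_lt_one hR'0]; exact hR'
  have hκ1 : κ ≤ 1 := by
    have : 0 < R / R' := by positivity
    linarith
  have hRκ : R = (1 - κ) * R' := by rw [hκ]; field_simp; ring
  -- two radii between `R` and `R'`
  set r₁ := R + κ * R' / 4 with hr₁
  set r₂ := R + κ * R' / 8 with hr₂
  have hκR : 0 < κ * R' := by positivity
  have hr₂R : R < r₂ := by linarith
  have hr₂₁ : r₂ < r₁ := by linarith
  have hr₁0 : 0 < r₁ := by linarith
  have hlog : 0 < Real.log r₁ - Real.log r₂ := by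
    have := Real.log_lt_log (hR.trans hr₂R) hr₂₁; linarith
  set E := 1 / (α / (M ^ 2 * Real.pi) * (Real.log r₁ - Real.log r₂)) with hE
  have hE0 : 0 < E := by have := Real.pi_pos; positivity
  have hK0 : 0 < K := by linarith
  set C := 4 * (√(2 * K) * ((32 * r₁ / κ) ^ α * √E * 3 ^ α)) / α with hC
  refine ⟨C, by positivity, fun p q h => ?_⟩
  have main : ∀ r, R' ≤ r → ∀ x y : ℝ × ℝ, 0 < x.2 → 0 < y.2 → r ≤ rad x → r ≤ rad y →
      24 * dist x y ≤ κ * r → |p x - p y| ≤ C * (dist x y ^ α * r ^ (-(2 * α))) ∧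
        |q x - q y| ≤ C * (dist x y ^ α * r ^ (-(2 * α))) := by
    intro r hr x y hx hy hrx hry hxy
    have hr0 : 0 < r := hR'0.trans_le hr
    have hκr : 0 < κ * r := by positivity
    have hκrr : κ * r ≤ r := by nlinarith
    have hRr : R + κ * r ≤ r := by nlinarith
    have hκR'r : κ * R' ≤ κ * r := by gcongr
    have hout := (h.qc.energy_exterior_le hK hM h.abs_snd_le h.tendsto_snd hR hr₂R).2 hr₂₁
    have hfar := (h.qc.energy_exterior_le hK hM h.abs_snd_le h.tendsto_snd hR
      (hr₂R.trans hr₂₁) (ρ := r - 3 * (κ * r / 4))).1 (by linarith)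
    set A := (32 * r₁ / κ) ^ α * √E * r ^ (-(2 * α)) with hA
    have key := h.qc.abs_sub_le_of_energy hK (α := α) (A := A) hα (by positivity) hx hy
      (by linarith) ?_
    · have e : 4 * (√(2 * K) * (A * (3 * dist x y) ^ α)) / α
          = C * (dist x y ^ α * r ^ (-(2 * α))) := by
        rw [hC, hA, Real.mul_rpow (by norm_num) dist_nonneg]; ring
      rwa [e] at key
    · intro v hv ρ hρ hρd
      have hv2 : 0 < v.2 := by rcases hv with rfl | rfl <;> assumption
      have hvr : r ≤ rad v := by rcases hv with rfl | rfl <;> assumption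
      have h1 := h.qc.energy_near_le hK hM h.abs_snd_le h.tendsto_snd (z := v) (r := κ * r / 4)
        (ρ := ρ) hv2 (by positivity) (by linarith) hρ (by linarith)
      have h2 : energy p q {w | 0 < w.2 ∧ rad v - 3 * (κ * r / 4) < rad w} ≤
          energy p q {w | 0 < w.2 ∧ r - 3 * (κ * r / 4) < rad w} :=
        energy_mono fun w hw => ⟨hw.1, by linarith [hw.2]⟩
      refine h1.trans ((mul_le_mul_right (h2.trans (hfar.trans (mul_le_mul_right hout _))) _).trans ?_)
      rw [← ENNReal.ofReal_mul (by have : 0 < r - 3 * (κ * r / 4) := by linarith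
                                   positivity), ← ENNReal.ofReal_mul (by positivity)]
      apply ENNReal.ofReal_le_ofReal
      have b1 : (r₁ / (r - 3 * (κ * r / 4))) ^ (2 * α) ≤ (4 * r₁ / r) ^ (2 * α) := by
        have : 0 < r - 3 * (κ * r / 4) := by linarith
        refine Real.rpow_le_rpow (by positivity) ?_ (by positivity)
        rw [div_le_div_iff₀ this hr0]
        nlinarith
      calc (2 * ρ / (κ * r / 4)) ^ (2 * α) * ((r₁ / (r - 3 * (κ * r / 4))) ^ (2 * α) * E)
          ≤ (2 * ρ / (κ * r / 4)) ^ (2 * α) * ((4 * r₁ / r) ^ (2 * α) * E) := by gcongr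
        _ = (32 * r₁ / κ * ρ * (r ^ 2)⁻¹) ^ (2 * α) * E := by
          rw [← mul_assoc, ← Real.mul_rpow (by positivity) (by positivity)]
          congr 2; field_simp; ring
        _ = (A * ρ ^ α) ^ 2 := by
          rw [hA, Real.mul_rpow (by positivity) (by positivity),
            Real.mul_rpow (by positivity) hρ.le]
          have s1 : ∀ {x : ℝ}, 0 ≤ x → x ^ (2 * α) = (x ^ α) ^ 2 := fun hx => by
            rw [mul_comm, Real.rpow_mul hx]; norm_cast
          have s2 : (r ^ 2)⁻¹ ^ (2 * α) = (r ^ (-(2 * α))) ^ 2 := by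
            rw [Real.inv_rpow (by positivity), Real.rpow_neg hr0.le, inv_pow,
              ← Real.rpow_natCast r 2, ← Real.rpow_mul hr0.le, mul_comm, Real.rpow_mul hr0.le]
            norm_cast
          rw [s1 (by positivity), s1 hρ.le, s2]
          have := Real.sq_sqrt hE0.le
          linear_combination -((32 * r₁ / κ) ^ α * ρ ^ α * r ^ (-(2 * α))) ^ 2 * this
  exact ⟨fun r hr x y hx hy hrx hry hxy => (main r hr x y hx hy hrx hry hxy).1,
    fun r hr x y hx hy hrx hry hxy => (main r hr x y hx hy hrx hry hxy).2⟩

end Uniform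

section Chains

variable {C α κ R' : ℝ} {g : ℝ × ℝ → ℝ}

theorem rad_smul {t : ℝ} (ht : 0 ≤ t) (z : ℝ × ℝ) : rad (t • z) = t * rad z := by
  rw [rad_eq_sqrt, rad_eq_sqrt]
  simp only [Prod.smul_fst, Prod.smul_snd, smul_eq_mul]
  rw [show (t * z.1) ^ 2 + (t * z.2) ^ 2 = t ^ 2 * (z.1 ^ 2 + z.2 ^ 2) by ring,
    Real.sqrt_mul (sq_nonneg t), Real.sqrt_sq ht]

theorem rad_add_vert_ge (x : ℝ × ℝ) {t : ℝ} (hx : 0 ≤ x.2) (ht : 0 ≤ t) :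
    rad x ≤ rad (x + (0, t)) := by
  rw [rad_eq_sqrt, rad_eq_sqrt]
  apply Real.sqrt_le_sqrt
  simp only [Prod.fst_add, Prod.snd_add, add_zero]
  nlinarith

/-- Chaining the Hölder estimate along a segment whose length is comparable to its distance to the
origin. -/
theorem HolderFar.abs_sub_le_of_segment (h : HolderFar C α κ R' g) (hC : 0 < C) (hα : 0 < α) (hκ1 : κ ≤ 1)
    (hR' : 0 < R') {N : ℕ} (hN : 48 ≤ κ * N) {r : ℝ} (hr : R' ≤ r) {x y : ℝ × ℝ}
    (hxy : dist x y ≤ 2 * r)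
    (hseg : ∀ t ∈ Icc (0 : ℝ) 1, 0 < (x + t • (y - x)).2 ∧ r ≤ rad (x + t • (y - x))) :
    |g x - g y| ≤ N * C * r ^ (-α) := by
  have hr0 : 0 < r := hR'.trans_le hr
  have hN0 : 0 < (N : ℝ) := by
    by_contra! h0
    nlinarith
  set u : ℕ → ℝ × ℝ := fun i => x + ((i : ℝ) / N) • (y - x) with hu
  have hstep : ∀ i < N, dist (g (u i)) (g (u (i + 1))) ≤ C * r ^ (-α) := by
    intro i hi
    have m : ∀ j : ℕ, j ≤ N → ((j : ℝ) / N) ∈ Icc (0 : ℝ) 1 := fun j hj =>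
      ⟨by positivity, by rw [div_le_one hN0]; exact_mod_cast hj⟩
    have h1 := hseg _ (m i hi.le)
    have h2 := hseg _ (m (i + 1) hi)
    have hd : dist (u i) (u (i + 1)) = dist x y / N := by
      rw [dist_eq_norm, hu]
      simp only
      rw [add_sub_add_left_eq_sub, ← sub_smul, norm_smul, Nat.cast_add_one, ← sub_div,
        sub_add_cancel_left, norm_div, norm_neg, norm_one, Real.norm_of_nonneg hN0.le,
        ← dist_eq_norm, dist_comm]
      ring
    have hd2 : 24 * dist (u i) (u (i + 1)) ≤ κ * r := by
      rw [hd, ← mul_div_assoc, div_le_iff₀ hN0]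
      nlinarith
    have hd3 : dist (u i) (u (i + 1)) ≤ r := by nlinarith
    rw [Real.dist_eq]
    refine (h r hr _ _ h1.1 h2.1 h1.2 h2.2 hd2).trans ?_
    gcongr
    calc dist (u i) (u (i + 1)) ^ α * r ^ (-(2 * α)) ≤ r ^ α * r ^ (-(2 * α)) := by gcongr
      _ = r ^ (-α) := by rw [← Real.rpow_add hr0]; ring_nf
  have hsum := dist_le_range_sum_dist (fun i => g (u i)) N
  have h0 : u 0 = x := by simp [hu]
  have hN1 : u N = y := by simp [hu, div_self hN0.ne']
  simp only [h0, hN1] at hsum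
  rw [Real.dist_eq] at hsum
  refine hsum.trans ((Finset.sum_le_card_nsmul _ _ (C * r ^ (-α)) fun i hi =>
    hstep i (Finset.mem_range.1 hi)).trans_eq ?_)
  simp [mul_assoc]

/-- Oscillation on a dyadic half-annulus: every point is joined to `(0, 4 r)` by three segments. -/
theorem HolderFar.abs_sub_le_of_annulus (h : HolderFar C α κ R' g) (hC : 0 < C) (hα : 0 < α) (hκ1 : κ ≤ 1)
    (hR' : 0 < R') {N : ℕ} (hN : 48 ≤ κ * N) {r : ℝ} (hr : R' ≤ r) {x : ℝ × ℝ}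
    (hx : 0 < x.2) (hrx : r ≤ rad x) (hxr : rad x ≤ 2 * r) :
    |g x - g (0, 4 * r)| ≤ 3 * (N * C * r ^ (-α)) := by
  have hr0 : 0 < r := hR'.trans_le hr
  have hx1 : |x.1| ≤ 2 * r := (Complex.abs_re_le_norm ⟨x.1, x.2⟩).trans hxr
  have hx2 : x.2 ≤ 2 * r := ((le_abs_self _).trans (abs_snd_le_rad x)).trans hxr
  have s1 := h.abs_sub_le_of_segment hC hα hκ1 hR' hN hr (x := x) (y := x + (0, 2 * r))
    (by rw [dist_self_add_right, Prod.norm_def]; simp [abs_of_pos hr0, hr0.le]) (fun t ht => by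
      have e : x + t • (x + (0, 2 * r) - x) = x + (0, t * (2 * r)) := by
        rw [add_sub_cancel_left]; simp
      have h0 : 0 ≤ t * (2 * r) := mul_nonneg ht.1 (by linarith)
      rw [e]
      exact ⟨by simp only [Prod.snd_add]; linarith, hrx.trans (rad_add_vert_ge x hx.le h0)⟩)
  have s2 := h.abs_sub_le_of_segment hC hα hκ1 hR' hN hr (x := x + (0, 2 * r))
    (y := (0, x.2 + 2 * r)) (by
      rw [Prod.dist_eq, max_le_iff, Real.dist_eq, Real.dist_eq]
      simp only [Prod.fst_add, Prod.snd_add, add_zero, sub_zero, sub_self, abs_zero]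
      exact ⟨hx1, by linarith⟩) (fun t ht => by
      have e : (x + (0, 2 * r) + t • ((0, x.2 + 2 * r) - (x + (0, 2 * r)))).2 = x.2 + 2 * r := by
        simp
      refine ⟨by rw [e]; linarith, le_trans ?_ ((le_abs_self _).trans (abs_snd_le_rad _))⟩
      rw [e]; linarith)
  have s3 := h.abs_sub_le_of_segment hC hα hκ1 hR' hN hr (x := (0, x.2 + 2 * r))
    (y := (0, 4 * r)) (by
      rw [Prod.dist_eq, max_le_iff, Real.dist_eq, Real.dist_eq]
      simp only [sub_self, abs_zero]
      exact ⟨by linarith, by rw [abs_le]; constructor <;> linarith⟩) (fun t ht => by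
      have e : (((0, x.2 + 2 * r) : ℝ × ℝ) + t • ((0, 4 * r) - (0, x.2 + 2 * r))).2 =
          x.2 + 2 * r + t * (4 * r - (x.2 + 2 * r)) := by simp
      have e2 : r ≤ x.2 + 2 * r + t * (4 * r - (x.2 + 2 * r)) := by nlinarith [ht.1, ht.2]
      refine ⟨by rw [e]; linarith, le_trans ?_ ((le_abs_self _).trans (abs_snd_le_rad _))⟩
      rw [e]; exact e2)
  have t1 := abs_sub_le (g x) (g (x + (0, 2 * r))) (g (0, 4 * r))
  have t2 := abs_sub_le (g (x + (0, 2 * r))) (g (0, x.2 + 2 * r)) (g (0, 4 * r))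
  linarith

/-- Oscillation outside a half-disc, by summing over dyadic half-annuli. -/
theorem exists_oscillation_bound (hC : 0 < C) (hα : 0 < α) (hκ : 0 < κ) (hκ1 : κ ≤ 1)
    (hR' : 0 < R') : ∃ C', 0 < C' ∧ ∀ g, HolderFar C α κ R' g → ∀ r, R' ≤ r → ∀ x y : ℝ × ℝ,
      0 < x.2 → 0 < y.2 → r ≤ rad x → r ≤ rad y → |g x - g y| ≤ C' * r ^ (-α) := by
  obtain ⟨N, hN⟩ := exists_nat_ge (48 / κ)
  rw [div_le_iff₀ hκ, mul_comm] at hN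
  have hN0 : 0 < (N : ℝ) := by
    by_contra! h0
    nlinarith
  have hlam : (2 : ℝ) ^ (-α) < 1 := Real.rpow_lt_one_of_one_lt_of_neg (by norm_num) (by linarith)
  set lam := (2 : ℝ) ^ (-α) with hlamdef
  have hlam0 : 0 < lam := by positivity
  set C₅ := 6 * (N * C) with hC₅
  have hC₅0 : 0 < C₅ := by positivity
  have h1lam : 0 < 1 - lam := by linarith
  -- the sum of the geometric series of the oscillations on dyadic annuli
  set C₆ := C₅ / (1 - lam) with hC₆
  have hC₆0 : 0 < C₆ := by positivity
  have hC₆eq : C₅ + C₆ * lam = C₆ := by rw [hC₆]; field_simp; ring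
  refine ⟨C₆, hC₆0, fun g h => ?_⟩
  have ann : ∀ r, R' ≤ r → ∀ x y : ℝ × ℝ, 0 < x.2 → 0 < y.2 → r ≤ rad x → r ≤ rad y →
      rad x ≤ 2 * r → rad y ≤ 2 * r → |g x - g y| ≤ C₅ * r ^ (-α) := by
    intro r hr x y hx hy hrx hry hxr hyr
    have e1 := h.abs_sub_le_of_annulus hC hα hκ1 hR' hN hr hx hrx hxr
    have e2 := h.abs_sub_le_of_annulus hC hα hκ1 hR' hN hr hy hry hyr
    have e3 := abs_sub_le (g x) (g (0, 4 * r)) (g y)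
    rw [abs_sub_comm (g (0, 4 * r))] at e3
    rw [hC₅]; linarith
  have ind : ∀ n : ℕ, ∀ x y : ℝ × ℝ, 0 < x.2 → 0 < y.2 → R' ≤ rad x → rad x ≤ rad y →
      rad y ≤ 2 ^ n * rad x → |g x - g y| ≤ C₆ * rad x ^ (-α) := by
    intro n
    induction n with
    | zero =>
      intro x y hx hy hR hxy hyx
      have hx0 : 0 < rad x := hR'.trans_le hR
      refine (ann _ hR x y hx hy le_rfl hxy (by linarith) (by simp at hyx; linarith)).trans ?_
      gcongr; nlinarith
    | succ n ih =>
      intro x y hx hy hR hxy hyx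
      have hx0 : 0 < rad x := hR'.trans_le hR
      rcases le_or_gt (rad y) (2 * rad x) with hle | hlt
      · refine (ann _ hR x y hx hy le_rfl hxy (by linarith) hle).trans ?_
        gcongr; nlinarith
      · have hr2 : rad ((2 : ℝ) • x) = 2 * rad x := rad_smul (by norm_num) x
        have hx2 : 0 < ((2 : ℝ) • x).2 := by simpa using hx
        have e1 := ann _ hR x ((2 : ℝ) • x) hx hx2 le_rfl (by linarith) (by linarith) hr2.le
        have e2 := ih ((2 : ℝ) • x) y hx2 hy (by linarith) (by linarith)
          (by rw [hr2]; rw [pow_succ] at hyx; linarith)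
        rw [hr2, Real.mul_rpow (by norm_num) hx0.le] at e2
        have e3 := abs_sub_le (g x) (g ((2 : ℝ) • x)) (g y)
        calc |g x - g y| ≤ (C₅ + C₆ * lam) * rad x ^ (-α) := by rw [hlamdef]; linarith
          _ = _ := by rw [hC₆eq]
  have ord : ∀ r, R' ≤ r → ∀ x y : ℝ × ℝ, 0 < x.2 → 0 < y.2 → r ≤ rad x → rad x ≤ rad y →
      |g x - g y| ≤ C₆ * r ^ (-α) := by
    intro r hr x y hx hy hrx hxy
    have hr0 : 0 < r := hR'.trans_le hr
    have hx0 : 0 < rad x := hr0.trans_le hrx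
    obtain ⟨n, hn⟩ := pow_unbounded_of_one_lt (rad y / rad x) (by norm_num : (1 : ℝ) < 2)
    rw [div_lt_iff₀ hx0] at hn
    refine (ind n x y hx hy (hr.trans hrx) hxy hn.le).trans ?_
    gcongr ?_ * ?_
    exact Real.rpow_le_rpow_of_nonpos hr0 hrx (by linarith)
  intro r hr x y hx hy hrx hry
  rcases le_total (rad x) (rad y) with hxy | hxy
  · exact ord r hr x y hx hy hrx hxy
  · rw [abs_sub_comm]; exact ord r hr y x hy hx hry hxy

end Chains

/-! ### Transfer to the Euclidean plane -/

section Transfer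

/-- The point of `Plane` with given coordinates, as a continuous linear equivalence. -/
noncomputable def toPlane : (ℝ × ℝ) ≃L[ℝ] Plane :=
  (ContinuousLinearEquiv.finTwoArrow ℝ ℝ).symm.trans (EuclideanSpace.equiv (Fin 2) ℝ).symm

theorem toPlane_one (z : ℝ × ℝ) : toPlane z 1 = z.2 := rfl

theorem toPlane_coords (x : Plane) : toPlane (x 0, x 1) = x := by
  ext i; fin_cases i <;> rfl

theorem toPlane_pair (a b : ℝ) : toPlane (a, b) = !₂[a, b] := by
  ext i; fin_cases i <;> rfl

theorem rad_coords (x : Plane) : rad (x 0, x 1) = ‖x‖ := by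
  rw [rad_eq_sqrt, EuclideanSpace.norm_eq, Fin.sum_univ_two]; simp

theorem norm_toPlane (z : ℝ × ℝ) : ‖toPlane z‖ = rad z := (rad_coords (toPlane z)).symm

theorem norm_le_abs_add_abs (x : Plane) : ‖x‖ ≤ |x 0| + |x 1| := by
  rw [← rad_coords]; exact rad_le _

theorem abs_coord_le_norm (x : Plane) (i : Fin 2) : |x i| ≤ ‖x‖ := PiLp.norm_apply_le x i

theorem dist_coords_le (x y : Plane) : dist (x 0, x 1) (y 0, y 1) ≤ ‖x - y‖ := by
  rw [Prod.dist_eq, max_le_iff, Real.dist_eq, Real.dist_eq]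
  exact ⟨abs_coord_le_norm (x - y) 0, abs_coord_le_norm (x - y) 1⟩

theorem mem_upperHalf_diff {R : ℝ} {x : Plane} :
    x ∈ upperHalf \ closedHalfDisc R ↔ 0 < x 1 ∧ R < ‖x‖ := by
  simp only [upperHalf, closedHalfDisc, closedUpperHalf, Set.mem_sdiff, mem_inter_iff,
    mem_closedBall_zero_iff]
  change 0 < x 1 ∧ ¬(‖x‖ ≤ R ∧ 0 ≤ x 1) ↔ _
  constructor
  · rintro ⟨h1, h2⟩; exact ⟨h1, not_le.1 fun h => h2 ⟨h, h1.le⟩⟩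
  · rintro ⟨h1, h2⟩; exact ⟨h1, fun h => absurd h.1 (not_le.2 h2)⟩

theorem mem_closedUpperHalf_diff {R : ℝ} {x : Plane} :
    x ∈ closedUpperHalf \ closedHalfDisc R ↔ 0 ≤ x 1 ∧ R < ‖x‖ := by
  simp only [closedHalfDisc, closedUpperHalf, Set.mem_sdiff, mem_inter_iff, mem_closedBall_zero_iff]
  change 0 ≤ x 1 ∧ ¬(‖x‖ ≤ R ∧ 0 ≤ x 1) ↔ _
  constructor
  · rintro ⟨h1, h2⟩; exact ⟨h1, not_le.1 fun h => h2 ⟨h, h1⟩⟩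
  · rintro ⟨h1, h2⟩; exact ⟨h1, fun h => absurd h.1 (not_le.2 h2)⟩

theorem mem_flatBoundary_of_eq_zero {R : ℝ} {x : Plane} (hx : x 1 = 0) (hR : R < ‖x‖) :
    x ∈ flatBoundary R := by
  refine ⟨?_, hx⟩
  rwa [← rad_coords, hx, rad_real] at hR

theorem partialD_coords (f : Plane → ℝ) (z : ℝ × ℝ) :
    partialD 0 f (toPlane z) = dx (fun z => f (toPlane z)) z ∧
      partialD 1 f (toPlane z) = dy (fun z => f (toPlane z)) z := by
  have h : fderiv ℝ (fun z => f (toPlane z)) z =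
      (fderiv ℝ f (toPlane z)).comp (toPlane : (ℝ × ℝ) →L[ℝ] Plane) :=
    toPlane.comp_right_fderiv
  unfold partialD dx dy
  rw [h]
  have e0 : EuclideanSpace.single (0 : Fin 2) (1 : ℝ) = toPlane (1, 0) := by
    ext i; fin_cases i <;> simp [toPlane_pair]
  have e1 : EuclideanSpace.single (1 : Fin 2) (1 : ℝ) = toPlane (0, 1) := by
    ext i; fin_cases i <;> simp [toPlane_pair]
  rw [e0, e1]
  exact ⟨rfl, rfl⟩

variable {K R M : ℝ} {w : Plane → Plane}

theorem exteriorMap_of_isQuasiconformalOn (hw : IsQuasiconformalOn K w (upperHalf \ closedHalfDisc R))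
    (hc : ContinuousOn w ((upperHalf \ closedHalfDisc R) ∪ flatBoundary R))
    (hq : ∀ x ∈ flatBoundary R, w x 1 = 0)
    (hM : ∀ x ∈ upperHalf \ closedHalfDisc R, ‖w x‖ ≤ M) :
    ExteriorMap K R M (fun z => w (toPlane z) 0) (fun z => w (toPlane z) 1) := by
  have hmem : ∀ z : ℝ × ℝ, 0 < z.2 → R < rad z → toPlane z ∈ upperHalf \ closedHalfDisc R :=
    fun z h1 h2 => mem_upperHalf_diff.2 ⟨h1, by rwa [norm_toPlane]⟩
  have hcd : ∀ i, ContDiffOn ℝ 1 (fun z => w (toPlane z) i) {z | 0 < z.2 ∧ R < rad z} := by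
    intro i
    have h1 : ContDiffOn ℝ 1 (fun x => w x i) (upperHalf \ closedHalfDisc R) :=
      (contDiffOn_euclidean.1 hw.contDiffOn) i
    exact h1.comp toPlane.contDiff.contDiffOn fun z hz => hmem z hz.1 hz.2
  refine ⟨⟨hcd 0, hcd 1, fun z hz => ?_⟩, fun z h1 h2 => ?_, fun y hy => ?_⟩
  · have h := hw.distortion _ (hmem z hz.1 hz.2)
    rw [(partialD_coords _ z).1, (partialD_coords _ z).2, (partialD_coords _ z).1,
      (partialD_coords _ z).2] at h
    exact h
  · exact (abs_coord_le_norm _ 1).trans (hM _ (hmem z h1 h2))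
  · have hy0 : toPlane (y, 0) ∈ flatBoundary R := ⟨hy, rfl⟩
    have hcy := hc _ (Or.inr hy0)
    have hto : Tendsto toPlane (𝓝[{z | 0 < z.2}] (y, 0))
        (𝓝[(upperHalf \ closedHalfDisc R) ∪ flatBoundary R] (toPlane (y, 0))) := by
      refine tendsto_nhdsWithin_iff.2 ⟨(toPlane.continuous.tendsto _).mono_left nhdsWithin_le_nhds, ?_⟩
      have hev : ∀ᶠ z in 𝓝 ((y, 0) : ℝ × ℝ), R < rad z :=
        continuous_rad.continuousAt.eventually (by rw [rad_real]; exact lt_mem_nhds hy)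
      filter_upwards [self_mem_nhdsWithin, hev.filter_mono nhdsWithin_le_nhds] with z h1 h2
      exact Or.inl (hmem z h1 h2)
    have hev : Continuous fun v : Plane => v 1 := by fun_prop
    have := (hev.tendsto (w (toPlane (y, 0)))).comp (hcy.tendsto.comp hto)
    rwa [hq _ hy0] at this

/-- Upward translates, used to approach boundary points from inside. -/
theorem tendsto_translate (hc : ContinuousOn w ((upperHalf \ closedHalfDisc R) ∪ flatBoundary R))
    {x : Plane} (hx : 0 ≤ x 1) (hxR : R < ‖x‖) :
    Tendsto (fun ε : ℝ => w (toPlane (x 0, x 1 + ε))) (𝓝[>] 0) (𝓝 (w x)) := by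
  have hxD : x ∈ (upperHalf \ closedHalfDisc R) ∪ flatBoundary R := by
    rcases hx.eq_or_lt with h | h
    · exact Or.inr (mem_flatBoundary_of_eq_zero h.symm hxR)
    · exact Or.inl (mem_upperHalf_diff.2 ⟨h, hxR⟩)
  refine (hc x hxD).tendsto.comp (tendsto_nhdsWithin_iff.2 ⟨?_, ?_⟩)
  · have h1 : Continuous fun ε : ℝ => toPlane (x 0, x 1 + ε) := by fun_prop
    have h2 := h1.tendsto 0
    simp only [add_zero, toPlane_coords] at h2
    exact h2.mono_left nhdsWithin_le_nhds
  · filter_upwards [self_mem_nhdsWithin] with ε hε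
    have hε' : 0 < ε := hε
    refine Or.inl (mem_upperHalf_diff.2 ⟨?_, ?_⟩)
    · rw [toPlane_one]; simp only; linarith
    · rw [norm_toPlane]
      have := rad_add_vert_ge (x 0, x 1) hx hε'.le
      simp only [Prod.mk_add_mk, add_zero] at this
      rw [rad_coords] at this
      exact hxR.trans_le this

/-- An estimate for pairs of points of the open half-plane that depends only on their difference
and on a lower bound for their norms extends to the boundary. -/
theorem norm_sub_le_of_interior
    (hc : ContinuousOn w ((upperHalf \ closedHalfDisc R) ∪ flatBoundary R)) {r B : ℝ} {x y : Plane}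
    (hx : 0 ≤ x 1) (hxR : R < ‖x‖) (hy : 0 ≤ y 1) (hyR : R < ‖y‖) (hxr : r ≤ ‖x‖) (hyr : r ≤ ‖y‖)
    (h : ∀ x' y' : Plane, 0 < x' 1 → 0 < y' 1 → r ≤ ‖x'‖ → r ≤ ‖y'‖ → x' - y' = x - y →
      ‖w x' - w y'‖ ≤ B) : ‖w x - w y‖ ≤ B := by
  refine le_of_tendsto ((tendsto_translate hc hx hxR).sub (tendsto_translate hc hy hyR)).norm ?_
  filter_upwards [self_mem_nhdsWithin] with ε hε
  have hε' : 0 < ε := hε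
  have hn : ∀ v : Plane, 0 ≤ v 1 → ‖v‖ ≤ ‖toPlane (v 0, v 1 + ε)‖ := fun v hv => by
    have := rad_add_vert_ge (v 0, v 1) hv hε'.le
    simp only [Prod.mk_add_mk, add_zero] at this
    rwa [rad_coords, ← norm_toPlane] at this
  refine h _ _ ?_ ?_ (hxr.trans (hn x hx)) (hyr.trans (hn y hy)) ?_
  · rw [toPlane_one]; simp only; linarith
  · rw [toPlane_one]; simp only; linarith
  · rw [← map_sub, ← toPlane_coords (x - y)]
    congr 1
    ext <;> simp

end Transfer

theorem theorem4p3 (K R R' M : ℝ) (hK : 1 ≤ K) (hR : 0 < R) (hR' : R < R') :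
    ∃ C : ℝ, 0 < C ∧ ∀ w : Plane → Plane,
      IsQuasiconformalOn K w (upperHalf \ closedHalfDisc R) →
      ContinuousOn w ((upperHalf \ closedHalfDisc R) ∪ flatBoundary R) →
      (∀ x ∈ flatBoundary R, w x 1 = 0) →
      (∀ x ∈ upperHalf \ closedHalfDisc R, ‖w x‖ ≤ M) →
      (∀ x ∈ closedUpperHalf \ closedHalfDisc R', ∀ y ∈ closedUpperHalf \ closedHalfDisc R',
        ‖w x - w y‖ ≤ C * ‖x - y‖ ^ (K - √(K ^ 2 - 1))) ∧
      ∃ pInf : ℝ,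
        Tendsto w (Bornology.cobounded Plane ⊓ 𝓟 closedUpperHalf) (𝓝 !₂[pInf, 0]) ∧
        ∀ x ∈ closedUpperHalf \ closedHalfDisc R',
          ‖w x - !₂[pInf, 0]‖ ≤ C * ‖x‖ ^ (-(K - √(K ^ 2 - 1))) := by
  have hα := expo_pos hK
  set α := K - √(K ^ 2 - 1) with hαdef
  have hR'0 : 0 < R' := hR.trans hR'
  -- a positive bound for `‖w‖`
  set M' := max M 1 with hM'
  have hM'0 : 0 < M' := lt_max_of_lt_right one_pos
  set κ := 1 - R / R' with hκ
  have hκ0 : 0 < κ := by rw [hκ, sub_pos, div_lt_one hR'0]; exact hR'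
  have hκ1 : κ ≤ 1 := by
    have : 0 < R / R' := by positivity
    linarith
  obtain ⟨C₁, hC₁, hloc⟩ := exists_holderFar hK hR hR' hM'0
  obtain ⟨C₂, hC₂, hosc⟩ := exists_oscillation_bound hC₁ hα hκ0 hκ1 hR'0
  set C₃ := 2 * M' * (24 / (κ * R')) ^ α with hC₃
  have hC₃0 : 0 < C₃ := by positivity
  refine ⟨2 * C₁ * R' ^ (-(2 * α)) + C₃ + 2 * C₂, by positivity, fun w hw hc hq hM => ?_⟩
  set C := 2 * C₁ * R' ^ (-(2 * α)) + C₃ + 2 * C₂ with hC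
  have hCpos : 0 ≤ 2 * C₁ * R' ^ (-(2 * α)) := by positivity
  have hM2 : ∀ x ∈ upperHalf \ closedHalfDisc R, ‖w x‖ ≤ M' := fun x hx =>
    (hM x hx).trans (le_max_left _ _)
  have hext := exteriorMap_of_isQuasiconformalOn hw hc hq hM2
  obtain ⟨hp, hq'⟩ := hloc _ _ hext
  have hosc' : ∀ r, R' ≤ r → ∀ x y : Plane, 0 ≤ x 1 → 0 ≤ y 1 → R' < ‖x‖ → R' < ‖y‖ → r ≤ ‖x‖ →
      r ≤ ‖y‖ → ‖w x - w y‖ ≤ C * r ^ (-α) := by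
    intro r hr x y hx hy hxR hyR hrx hry
    have hr0 : 0 < r := hR'0.trans_le hr
    refine norm_sub_le_of_interior hc hx (hR'.trans hxR) hy (hR'.trans hyR) hrx hry ?_
    intro x' y' hx' hy' hrx' hry' _
    rw [← rad_coords] at hrx' hry'
    have e1 := hosc _ hp r hr _ _ hx' hy' hrx' hry'
    have e2 := hosc _ hq' r hr _ _ hx' hy' hrx' hry'
    simp only [toPlane_coords] at e1 e2
    have e3 := norm_le_abs_add_abs (w x' - w y')
    simp only [PiLp.sub_apply] at e3
    have e4 : 2 * C₂ * r ^ (-α) ≤ C * r ^ (-α) := by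
      gcongr; rw [hC]; linarith
    linarith
  refine ⟨fun x hx y hy => ?_, ?_⟩
  · rw [mem_closedUpperHalf_diff] at hx hy
    refine norm_sub_le_of_interior hc hx.1 (hR'.trans hx.2) hy.1 (hR'.trans hy.2) hx.2.le hy.2.le ?_
    intro x' y' hx' hy' hrx' hry' hsub
    rw [← hsub]
    rw [← rad_coords] at hrx' hry'
    rcases le_or_gt (24 * dist (x' 0, x' 1) (y' 0, y' 1)) (κ * R') with hle | hlt
    · have e1 := hp R' le_rfl _ _ hx' hy' hrx' hry' hle
      have e2 := hq' R' le_rfl _ _ hx' hy' hrx' hry' hle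
      simp only [toPlane_coords] at e1 e2
      have e3 := norm_le_abs_add_abs (w x' - w y')
      simp only [PiLp.sub_apply] at e3
      have e4 : dist (x' 0, x' 1) (y' 0, y' 1) ^ α ≤ ‖x' - y'‖ ^ α :=
        Real.rpow_le_rpow dist_nonneg (dist_coords_le x' y') hα.le
      calc ‖w x' - w y'‖
          ≤ 2 * C₁ * R' ^ (-(2 * α)) * dist (x' 0, x' 1) (y' 0, y' 1) ^ α := by linarith
        _ ≤ 2 * C₁ * R' ^ (-(2 * α)) * ‖x' - y'‖ ^ α := by gcongr
        _ ≤ C * ‖x' - y'‖ ^ α := by gcongr; rw [hC]; linarith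
    · -- distant points: the bound for `‖w‖` suffices
      have hx'm : x' ∈ upperHalf \ closedHalfDisc R :=
        mem_upperHalf_diff.2 ⟨hx', by rw [rad_coords] at hrx'; linarith⟩
      have hy'm : y' ∈ upperHalf \ closedHalfDisc R :=
        mem_upperHalf_diff.2 ⟨hy', by rw [rad_coords] at hry'; linarith⟩
      have e1 := norm_sub_le (w x') (w y')
      have e2 := hM2 x' hx'm
      have e3 := hM2 y' hy'm
      have e4 : 1 ≤ 24 / (κ * R') * ‖x' - y'‖ := by
        rw [div_mul_eq_mul_div, one_le_div (by positivity)]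
        have := dist_coords_le x' y'
        linarith
      have e5 : 1 ≤ (24 / (κ * R')) ^ α * ‖x' - y'‖ ^ α := by
        rw [← Real.mul_rpow (by positivity) (norm_nonneg _)]
        exact Real.one_le_rpow e4 hα.le
      calc ‖w x' - w y'‖ ≤ 2 * M' * 1 := by linarith
        _ ≤ 2 * M' * ((24 / (κ * R')) ^ α * ‖x' - y'‖ ^ α) := by gcongr
        _ = C₃ * ‖x' - y'‖ ^ α := by rw [hC₃]; ring
        _ ≤ C * ‖x' - y'‖ ^ α := by gcongr; rw [hC]; linarith
  · -- the limit along the boundary, which is the limit at infinity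
    set u : ℕ → Plane := fun n => toPlane (R' + 1 + n, 0) with hu
    have hun : ∀ n, ‖u n‖ = R' + 1 + n := fun n => by
      rw [hu, norm_toPlane, rad_real, abs_of_pos (by positivity)]
    have hu0 : ∀ n, 0 ≤ u n 1 := fun n => le_rfl
    have huR : ∀ n, R' < ‖u n‖ := fun n => by
      rw [hun]; have : (0 : ℝ) ≤ n := n.cast_nonneg; linarith
    have hdecay : Tendsto (fun r : ℝ => C * r ^ (-α)) atTop (𝓝 0) := by
      rw [← mul_zero C]; exact (tendsto_rpow_neg_atTop hα).const_mul C
    have hnat : Tendsto (fun n : ℕ => R' + 1 + (n : ℝ)) atTop atTop :=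
      tendsto_atTop_add_const_left _ _ tendsto_natCast_atTop_atTop
    have hcs : CauchySeq fun n => w (u n) := by
      refine cauchySeq_of_le_tendsto_0 (fun n : ℕ => C * (R' + 1 + (n : ℝ)) ^ (-α)) ?_
        (hdecay.comp hnat)
      intro n m N hn hm
      rw [dist_eq_norm]
      have hn' : (N : ℝ) ≤ n := by exact_mod_cast hn
      have hm' : (N : ℝ) ≤ m := by exact_mod_cast hm
      have hN : (0 : ℝ) ≤ N := N.cast_nonneg
      exact hosc' _ (by linarith) _ _ (hu0 n) (hu0 m) (huR n) (huR m) (by rw [hun]; linarith)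
        (by rw [hun]; linarith)
    obtain ⟨L, hL⟩ := cauchySeq_tendsto_of_complete hcs
    have hL1 : L 1 = 0 := by
      have hev : Continuous fun v : Plane => v 1 := by fun_prop
      have h1 := (hev.tendsto L).comp hL
      refine tendsto_nhds_unique h1 (tendsto_const_nhds.congr fun n => ?_)
      exact (hq _ (mem_flatBoundary_of_eq_zero rfl (hR'.trans (huR n)))).symm
    have hLeq : !₂[L 0, 0] = L := by
      rw [← toPlane_pair, ← hL1, toPlane_coords]
    have hbound : ∀ x ∈ closedUpperHalf \ closedHalfDisc R', ‖w x - L‖ ≤ C * ‖x‖ ^ (-α) := by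
      intro x hx
      rw [mem_closedUpperHalf_diff] at hx
      refine le_of_tendsto (tendsto_const_nhds.sub hL).norm ?_
      filter_upwards [hnat.eventually_ge_atTop ‖x‖] with n hn
      exact hosc' _ hx.2.le _ _ hx.1 (hu0 n) hx.2 (huR n) le_rfl (by rw [hun]; exact hn)
    refine ⟨L 0, ?_, ?_⟩
    · rw [hLeq, tendsto_iff_norm_sub_tendsto_zero]
      have hnorm : Tendsto (fun x : Plane => ‖x‖) (Bornology.cobounded Plane ⊓ 𝓟 closedUpperHalf)
          atTop := tendsto_norm_cobounded_atTop.mono_left inf_le_left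
      refine squeeze_zero' (Eventually.of_forall fun _ => norm_nonneg _) ?_ (hdecay.comp hnorm)
      filter_upwards [hnorm.eventually_gt_atTop R', mem_inf_of_right (mem_principal_self _)]
        with x h1 h2
      exact hbound x (mem_closedUpperHalf_diff.2 ⟨h2, h1⟩)
    · rw [hLeq]; exact hbound
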